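/- **Model.** An $\mathrm{SA}^{\circlearrowleft}$ algorithm consists of a finite state space $Q$, a finite message alphabet $\Sigma$, a transition function $\tau$ that maps every $(q,\chi)\in Q\times\{0,1\}^{\Sigma}$ to a non-empty subset of $Q\times\Sigma$, an initial state in $Q$ for each possible input, a set $Q_{out}\subseteq Q$ of output states, each of which encodes an output, and an initial message $\sigma_0\in\Sigma$. It is run by all nodes of a finite connected undirected graph $G=(V,E)$ that may have self-loops at any of its nodes. Each node $v$ has one port $\psi_v(u)$ for each neighbor $u$ (including $v$ itself if $v$ has a self-loop), which holds the last message of $u$ delivered to $v$, and initially $\sigma_0$. When $v$ is activated in state $q$, it draws its next state and next message $(q',\sigma')$ uniformly at random from $\tau(q,\chi_v)$, independently of all other choices, where $\chi_v(\sigma)=1$ if and only if $\sigma$ is written in at least one port of $v$; the message $\sigma'$ is sent to all neighbors of $v$. Activation times and message delays are chosen by an adversarial asynchronous scheduler that is oblivious to the random choices, subject only to: every node is activated infinitely often (and finitely often in every bounded time interval), message delays are positive and finite, and the messages from a node to a neighbor are delivered in FIFO order. The time unit is the supremum of the message delays and of the times between consecutive activations of a node (and from the beginning of the execution to its first activation).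 In the *$k$-leader selection* problem, the input marks at least $1$ and at most $k$ nodes as candidates; every node must output "leader" or "non-leader", and exactly one node, which must be a candidate, outputs "leader". Decisions are irrevocable: once a node enters an output state, it remains in output states encoding the same output. **Theorem.** There is a constant $a$ such that for all constants $k\in\mathbb{Z}_{\ge 1}$ and $c>0$ there exist an $\mathrm{SA}^{\circlearrowleft}$ algorithm $\mathcal{A}$ with irrevocable decisions and a constant $C$ such that the following holds for every finite connected graph $G$ (possibly with self-loops) with $n$ nodes and diameter $D$, every set of at least $1$ and at most $k$ candidates, and every schedule: 1. with probability $1$, all nodes eventually decide on an output; 2. with probability at least $1-n^{-c}$, the outputs form a correct leader selection and, if the time unit of the schedule is finite, all nodes have decided within $C\cdot D\cdot(\log n)^{a}$ time units, that is, within $\tilde{O}(D)$ time. -/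

import Mathlib

open Filter Set MeasureTheory

/-- A finite undirected graph that may have self-loops: the loop-free part `graph`, together with
the set `loops` of the nodes that carry a self-loop. -/
structure Network (V : Type) where
  graph : SimpleGraph V
  loops : Set V

/-- `N.Nbr u v`: there is an edge between `u` and `v`. In particular `N.Nbr v v` says that `v` has
a self-loop (and hence has an input port holding messages of its own). -/
def Network.Nbr {V : Type} (N : Network V) (u v : V) : Prop :=
  N.graph.Adj u v ∨ (u = v ∧ v ∈ N.loops)

/-- A randomized finite automaton with inputs in `I` and outputs in `O`. -/
structure SAAlgorithm (I O : Type) where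
  /-- the state space -/
  Q : Type
  /-- the message alphabet -/
  Msg : Type
  finite_Q : Finite Q
  finite_Msg : Finite Msg
  /-- The transition function: an activated node in state `q` whose ports have indicator vector `χ`
  (`χ σ` is true iff some port holds `σ`) picks its next state and next message uniformly at random
  from the set `τ q χ`. -/
  τ : Q → (Msg → Bool) → Finset (Q × Msg)
  τ_nonempty : ∀ q χ, (τ q χ).Nonempty
  /-- the initial state encoding a given input -/
  input : I → Q
  /-- `output q = some o` if `q` is an output state encoding the output `o`, and `output q = none`
  if `q` is not an output state -/
  output : Q → Option O
  /-- the message written in all the ports when the execution begins -/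
  σ₀ : Msg

namespace SAAlgorithm

variable {I O : Type}

instance (A : SAAlgorithm I O) : Finite A.Q := A.finite_Q

instance (A : SAAlgorithm I O) : Finite A.Msg := A.finite_Msg

instance (A : SAAlgorithm I O) : MeasurableSpace A.Q := ⊤

instance (A : SAAlgorithm I O) : MeasurableSpace A.Msg := ⊤

/-- Decisions are irrevocable: a node in an output state stays in output states that encode the same
output. -/
def Irrevocable (A : SAAlgorithm I O) : Prop :=
  ∀ q o, A.output q = some o → ∀ χ, ∀ p ∈ A.τ q χ, A.output p.1 = some o

/-- The random choices available to the nodes: `ω (v, i, q, χ)` is the (next state, next message)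
pair that node `v` picks in its activation number `i` if it is then in state `q` with port
indicator `χ`. -/
abbrev Choices (A : SAAlgorithm I O) (V : Type) : Type :=
  V × ℕ × A.Q × (A.Msg → Bool) → A.Q × A.Msg

/-- The law of the random choices: they are independent, and the choice that belongs to `q` and `χ`
is uniformly distributed in `τ q χ`. Every execution uses at most one choice for each node and
each activation number. -/
noncomputable def choiceMeasure (A : SAAlgorithm I O) (V : Type) : Measure (A.Choices V) :=
  Measure.infinitePi fun x : V × ℕ × A.Q × (A.Msg → Bool) =>
    (PMF.uniformOfFinset (A.τ x.2.2.1 x.2.2.2) (A.τ_nonempty _ _)).toMeasure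

end SAAlgorithm

/-- The policy of an asynchronous scheduler. The execution begins at time `0`.
`act v i` is the time of activation number `i = 0, 1, 2, …` of node `v`, and
`del u i v` is the time at which the message that `u` sends in its activation number `i` is written
into the port of its neighbor `v`. Node activations are instantaneous, message
delays are positive and finite, and delivery is FIFO. -/
structure Schedule {V : Type} (N : Network V) where
  act : V → ℕ → ℝ
  del : V → ℕ → V → ℝ
  act_pos : ∀ v, 0 < act v 0
  act_strictMono : ∀ v, StrictMono (act v)
  act_tendsto : ∀ v, Tendsto (act v) atTop atTop
  act_lt_del : ∀ u v, N.Nbr u v → ∀ i, act u i < del u i v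
  del_strictMono : ∀ u v, N.Nbr u v → StrictMono fun i => del u i v

namespace Schedule

variable {V : Type} {N : Network V}

/-- `b` is an upper bound on the time it takes to deliver any message and on the time between any
two consecutive activations of a node (and before its first activation). The time unit of the
execution is the least such `b`. -/
def BoundedBy (S : Schedule N) (b : ℝ) : Prop :=
  (∀ v, S.act v 0 ≤ b) ∧ (∀ v i, S.act v (i + 1) - S.act v i ≤ b) ∧
    ∀ u v, N.Nbr u v → ∀ i, S.del u i v - S.act u i ≤ b

/-- The (activation numbers of the) messages of `u` that have been written into the port of `v`
by time `t`. -/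
def delivered (S : Schedule N) (u v : V) (t : ℝ) : Set ℕ := {j | S.del u j v ≤ t}

theorem sSup_delivered_mem (S : Schedule N) {u v : V} (h : N.Nbr u v) {t : ℝ}
    (hne : (S.delivered u v t).Nonempty) : sSup (S.delivered u v t) ∈ S.delivered u v t := by
  refine Nat.sSup_mem hne ?_
  obtain ⟨B, hB⟩ := ((S.act_tendsto u).eventually_gt_atTop t).exists_forall_of_atTop
  refine ⟨B, fun j hj => ?_⟩
  by_contra hlt
  have h1 := hB j (by omega)
  have h2 := S.act_lt_del u v h j
  have h3 : S.del u j v ≤ t := hj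
  linarith

theorem act_sSup_delivered_lt (S : Schedule N) {u v : V} (h : N.Nbr u v) {t : ℝ}
    (hne : (S.delivered u v t).Nonempty) : S.act u (sSup (S.delivered u v t)) < t :=
  (S.act_lt_del u v h _).trans_le (S.sSup_delivered_mem h hne)

/-- The number of activations (of all the nodes) that precede activation number `i` of node `v`. -/
noncomputable def rank (S : Schedule N) (v : V) (i : ℕ) : ℕ :=
  {p : V × ℕ | S.act p.1 p.2 < S.act v i}.ncard

theorem rank_lt [Finite V] (S : Schedule N) {u v : V} {i j : ℕ} (h : S.act u j < S.act v i) :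
    S.rank u j < S.rank v i := by
  have hfin : {p : V × ℕ | S.act p.1 p.2 < S.act v i}.Finite := by
    choose B hB using fun w =>
      ((S.act_tendsto w).eventually_ge_atTop (S.act v i)).exists_forall_of_atTop
    refine (Set.Finite.biUnion (Set.finite_univ : (Set.univ : Set V).Finite)
      (t := fun w => (fun n => (w, n)) '' Set.Iio (B w))
      fun w _ => (Set.finite_Iio (B w)).image _).subset ?_
    rintro ⟨w, n⟩ hn
    simp only [Set.mem_iUnion, Set.mem_image, Set.mem_Iio, Set.mem_univ, exists_true_left]
    refine ⟨w, n, ?_, rfl⟩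
    by_contra hlt
    exact absurd hn (not_lt.2 (hB w n (not_lt.1 hlt)))
  refine Set.ncard_lt_ncard ⟨fun p hp => lt_trans hp h, fun hsub => ?_⟩ hfin
  exact lt_irrefl (S.act u j) (@hsub (u, j) h)

/-- The number of activations of node `v` up to time `t`. -/
noncomputable def numAct (S : Schedule N) (v : V) (t : ℝ) : ℕ := {i | S.act v i ≤ t}.ncard

end Schedule

namespace SAAlgorithm

variable {I O V : Type} {N : Network V}

open Classical in
/-- The pair (next state, next message) chosen by node `v` in its activation number `i`, when the
algorithm `A` is executed on `N` with inputs `inp` under the schedule `S` and the random choices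
`ω`. At that time, the port of `v` for its neighbor `u` holds the last message of `u` delivered so
far, and `σ₀` if there is none. -/
noncomputable def outcome [Finite V] (A : SAAlgorithm I O) (inp : V → I) (S : Schedule N) (ω : A.Choices V)
    (v : V) (i : ℕ) : A.Q × A.Msg :=
  let q : A.Q :=
    match i with
    | 0 => A.input (inp v)
    | i' + 1 => (outcome A inp S ω v i').1
  let port (u : V) (_hu : N.Nbr u v) : A.Msg :=
    if _h : (S.delivered u v (S.act v i)).Nonempty then
      (outcome A inp S ω u (sSup (S.delivered u v (S.act v i)))).2
    else A.σ₀
  ω (v, i, q, fun σ => decide (∃ (u : V) (hu : N.Nbr u v), port u hu = σ))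
termination_by S.rank v i
decreasing_by
  · exact S.rank_lt (S.act_strictMono v (Nat.lt_succ_self _))
  · exact S.rank_lt (S.act_sSup_delivered_lt (by assumption) (by assumption))

/-- The state of node `v` after its first `m` activations. -/
noncomputable def stateAfter [Finite V] (A : SAAlgorithm I O) (inp : V → I) (S : Schedule N)
    (ω : A.Choices V) (v : V) : ℕ → A.Q
  | 0 => A.input (inp v)
  | m + 1 => (A.outcome inp S ω v m).1

/-- The output that node `v` has decided on by time `t` (`none` if it has not decided yet). -/
noncomputable def outputAt [Finite V] (A : SAAlgorithm I O) (inp : V → I) (S : Schedule N)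
    (ω : A.Choices V) (t : ℝ) (v : V) : Option O :=
  A.output (A.stateAfter inp S ω v (S.numAct v t))

end SAAlgorithm

/-- Given the candidates (the nodes `v` with `cand v = true`), the outputs `out` of the nodes
select a leader: all the nodes have decided, exactly one of them is the leader
(output `true`), and it is a candidate. -/
def SelectsLeader {V : Type} (cand : V → Bool) (out : V → Option Bool) : Prop :=
  ∃ l, cand l = true ∧ out l = some true ∧ ∀ v, v ≠ l → out v = some false

/-! The algorithm has three layers.

An alpha synchronizer (`RoundRule.toSA`) turns synchronous rounds into asynchronous ones.
Neighboring pulses differ by at most one, so pulses mod 3 and the last two simulated states suffice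
(`RoundRule.outcome_toSA`). A pulse costs at most two time units (`Schedule.BoundedBy.pulse_ge`).
The pulses depend on the schedule alone, and the scheduler is oblivious, so the activations whose
coins drive the rounds are fixed in advance. Those coins are therefore independent and uniform
(`CoinRule.measure_coin_mem_le`).

Within the rounds, nodes compute mod 3 their distance to the nearest candidate and run waves that
alternately go down and up the resulting BFS layers. Each wave takes at most `D + 1` rounds
(`Network.le_count`). In each down-up pair, the set of candidates knowing a given piece of
information grows until it contains all of them, because the graph is connected. With at most `k`
candidates, a block of `2k + 2` counter steps thus performs a global broadcast (`Network.reach_all`,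
`ElectState.tracks_run`).

Per block, every surviving candidate is eliminated if another survivor has a larger color, and fresh
colors are drawn from a constant palette. Finite memory cannot count to `log n`, so every node also
runs a timer that stops with probability 1/2 per block; all nodes decide together once a block
reports no running timer. The last of `n` timers stops within `O(log n)` blocks with high
probability. A wrong result needs two candidates to agree in all `m` colors drawn while all timers
stop within `m` blocks. Colors and timers are independent, so this has probability at most `(1 -
2^(-m))^n / (L + 1)^m`. The first factor is at most `j! 2^(jm) / n^j`; a palette larger than `2^j`
by a constant factor makes the bounds summable over `m` with total `O(n^(-j))` (`measure_bad_le`).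
-/

namespace Schedule

variable {V : Type} {N : Network V}

/-- Well-founded induction along the order in which the activations happen. -/
theorem act_induction [Finite V] (S : Schedule N) {P : V → ℕ → Prop}
    (h : ∀ v i, (∀ u j, S.act u j < S.act v i → P u j) → P v i) (v : V) (i : ℕ) : P v i := by
  have key : ∀ n v i, S.rank v i = n → P v i := by
    intro n
    induction n using Nat.strong_induction_on with
    | _ n ih =>
      intro v i hn
      exact h v i fun u j hlt => ih _ (hn ▸ S.rank_lt hlt) u j rfl
  exact key _ v i rfl

theorem finite_act_le [Finite V] (S : Schedule N) (t : ℝ) :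
    {p : V × ℕ | S.act p.1 p.2 ≤ t}.Finite := by
  choose B hB using fun w =>
    ((S.act_tendsto w).eventually_gt_atTop t).exists_forall_of_atTop
  refine (Set.Finite.biUnion (Set.finite_univ : (Set.univ : Set V).Finite)
    (t := fun w => (fun n => (w, n)) '' Set.Iio (B w))
    fun w _ => (Set.finite_Iio (B w)).image _).subset ?_
  rintro ⟨w, n⟩ hn
  simp only [Set.mem_iUnion, Set.mem_image, Set.mem_Iio, Set.mem_univ, exists_true_left]
  refine ⟨w, n, ?_, rfl⟩
  by_contra hlt
  exact absurd hn (not_le.2 (hB w n (not_lt.1 hlt)))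

end Schedule

/-! ### Independence and uniformity of the coins of an asynchronous execution -/

namespace SAAlgorithm

variable {I O V : Type} {N : Network V} [Finite V]

open Classical in
/-- The content of the port of `v` for `u` at activation number `i` of `v`. -/
noncomputable def portAt (A : SAAlgorithm I O) (inp : V → I) (S : Schedule N) (ω : A.Choices V)
    (u v : V) (i : ℕ) : A.Msg :=
  if (S.delivered u v (S.act v i)).Nonempty then
    (A.outcome inp S ω u (sSup (S.delivered u v (S.act v i)))).2
  else A.σ₀

open Classical in
/-- The port indicator of `v` at its activation number `i`. -/
noncomputable def seen (A : SAAlgorithm I O) (inp : V → I) (S : Schedule N) (ω : A.Choices V)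
    (v : V) (i : ℕ) : A.Msg → Bool :=
  fun σ => decide (∃ u, N.Nbr u v ∧ A.portAt inp S ω u v i = σ)

theorem outcome_eq (A : SAAlgorithm I O) (inp : V → I) (S : Schedule N) (ω : A.Choices V)
    (v : V) (i : ℕ) :
    A.outcome inp S ω v i = ω (v, i, A.stateAfter inp S ω v i, A.seen inp S ω v i) := by
  rw [outcome.eq_def]
  classical
  have hseen : A.seen inp S ω v i = fun σ => decide (∃ (u : V) (_ : N.Nbr u v),
      (if (S.delivered u v (S.act v i)).Nonempty then
        (A.outcome inp S ω u (sSup (S.delivered u v (S.act v i)))).2 else A.σ₀) = σ) := by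
    funext σ
    simp only [seen, portAt, exists_prop]
    congr!
  rw [hseen]
  cases i <;> simp [stateAfter]

theorem stateAfter_congr {A : SAAlgorithm I O} {inp : V → I} {S : Schedule N} {ω ω' : A.Choices V}
    {v : V} {i : ℕ}
    (h : ∀ u j, S.act u j < S.act v i → A.outcome inp S ω u j = A.outcome inp S ω' u j) :
    A.stateAfter inp S ω v i = A.stateAfter inp S ω' v i := by
  cases i with
  | zero => rfl
  | succ i => simp only [stateAfter]; rw [h v i (S.act_strictMono v (Nat.lt_succ_self _))]

theorem seen_congr {A : SAAlgorithm I O} {inp : V → I} {S : Schedule N} {ω ω' : A.Choices V}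
    {v : V} {i : ℕ}
    (h : ∀ u j, S.act u j < S.act v i → A.outcome inp S ω u j = A.outcome inp S ω' u j) :
    A.seen inp S ω v i = A.seen inp S ω' v i := by
  have key : ∀ u, N.Nbr u v → A.portAt inp S ω u v i = A.portAt inp S ω' u v i := by
    intro u hu
    unfold portAt
    split_ifs with hne
    · rw [h _ _ (S.act_sSup_delivered_lt hu hne)]
    · rfl
  funext σ
  unfold seen
  congr 1
  apply propext
  constructor
  · rintro ⟨u, hu, rfl⟩; exact ⟨u, hu, (key u hu).symm⟩
  · rintro ⟨u, hu, rfl⟩; exact ⟨u, hu, key u hu⟩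

/-- A presentation of the transition function by a deterministic function of a uniform coin, which
can be read off from the outcome. -/
structure CoinRule (A : SAAlgorithm I O) (R : Type) where
  step : A.Q → (A.Msg → Bool) → R → A.Q × A.Msg
  coin : A.Q × A.Msg → R
  coin_step : ∀ q χ r, coin (step q χ r) = r
  mem_τ : ∀ q χ p, p ∈ A.τ q χ ↔ ∃ r, step q χ r = p

namespace CoinRule

variable {A : SAAlgorithm I O} {R : Type} (K : A.CoinRule R)

/-- The choices determined by a fixed coin for each activation. -/
def drive (ρ : V → ℕ → R) : A.Choices V := fun x => K.step x.2.2.1 x.2.2.2 (ρ x.1 x.2.1)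

theorem step_coin {q : A.Q} {χ : A.Msg → Bool} {p : A.Q × A.Msg} (h : p ∈ A.τ q χ) :
    K.step q χ (K.coin p) = p := by
  obtain ⟨r, rfl⟩ := (K.mem_τ q χ p).1 h
  rw [K.coin_step]

/-- The coins determine the execution: by induction over activations, both runs reach the same state
and see the same ports, and `step_coin` recovers the pair drawn from its coin. -/
theorem outcome_eq_drive {inp : V → I} {S : Schedule N} {ω : A.Choices V}
    (hω : ∀ x, ω x ∈ A.τ x.2.2.1 x.2.2.2) {T : ℝ} {ρ : V → ℕ → R}
    (hρ : ∀ v i, S.act v i ≤ T → K.coin (A.outcome inp S ω v i) = ρ v i) :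
    ∀ v i, S.act v i ≤ T → A.outcome inp S ω v i = A.outcome inp S (K.drive ρ) v i := by
  refine S.act_induction ?_
  intro v i ih hT
  have ih' : ∀ u j, S.act u j < S.act v i →
      A.outcome inp S ω u j = A.outcome inp S (K.drive ρ) u j :=
    fun u j h => ih u j h (h.le.trans hT)
  have h1 := hρ v i hT
  rw [outcome_eq] at h1 ⊢
  rw [outcome_eq A inp S (K.drive ρ), ← stateAfter_congr ih', ← seen_congr ih']
  simp only [drive]
  rw [← h1]
  exact (K.step_coin (hω (v, i, A.stateAfter inp S ω v i, A.seen inp S ω v i))).symm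

theorem outcome_eq_drive_coin {inp : V → I} {S : Schedule N} {ω : A.Choices V}
    (hω : ∀ x, ω x ∈ A.τ x.2.2.1 x.2.2.2) :
    A.outcome inp S ω = A.outcome inp S (K.drive fun v i => K.coin (A.outcome inp S ω v i)) := by
  funext v i
  exact K.outcome_eq_drive hω (T := S.act v i) (fun _ _ _ => rfl) v i le_rfl

/-- Since the coin can be read off the outcome, `step q χ` is injective. Hence a uniform element of
`τ q χ` amounts to a uniform coin, whatever `q` and `χ` are. -/
theorem card_τ (K : A.CoinRule R) [Fintype R] (q : A.Q) (χ : A.Msg → Bool) :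
    (A.τ q χ).card = Fintype.card R := by
  classical
  have : A.τ q χ = Finset.univ.image (K.step q χ) := by
    ext p; simp [K.mem_τ]
  rw [this, Finset.card_image_of_injective]
  · rfl
  · intro r s h
    rw [← K.coin_step q χ r, h, K.coin_step]

end CoinRule

theorem ae_mem_τ (A : SAAlgorithm I O) (V : Type) [Finite V] :
    ∀ᵐ ω ∂(A.choiceMeasure V), ∀ x, ω x ∈ A.τ x.2.2.1 x.2.2.2 := by
  have : Countable (V × ℕ × A.Q × (A.Msg → Bool)) := by
    have := Finite.to_countable (α := A.Q)
    have := Finite.to_countable (α := A.Msg → Bool)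
    have := Finite.to_countable (α := V)
    infer_instance
  rw [ae_all_iff]
  intro x
  have hmp := measurePreserving_eval_infinitePi
    (fun x : V × ℕ × A.Q × (A.Msg → Bool) =>
      (PMF.uniformOfFinset (A.τ x.2.2.1 x.2.2.2) (A.τ_nonempty _ _)).toMeasure) x
  refine hmp.quasiMeasurePreserving.ae
    (p := fun p => p ∈ A.τ x.2.2.1 x.2.2.2) ?_
  rw [ae_iff, PMF.toMeasure_apply_eq_zero_iff _ (MeasurableSet.of_discrete)]
  rw [Set.disjoint_left]
  intro p hp
  simpa using hp

namespace CoinRule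

variable {A : SAAlgorithm I O} {R : Type} (K : A.CoinRule R)

open ENNReal in
-- Fixing all coins up to `T` fixes the run up to `T`, hence which choices it consults. The event is
-- therefore almost surely contained in a cylinder with one coordinate per activation. An upper
-- bound is enough because only bad events are estimated.
theorem measure_coin_eq_le_of_time [Fintype R] (inp : V → I) (S : Schedule N) (T : ℝ)
    (ρ : V → ℕ → R) :
    A.choiceMeasure V {ω | ∀ v i, S.act v i ≤ T → K.coin (A.outcome inp S ω v i) = ρ v i} ≤
      ((Fintype.card R : ℝ≥0∞)⁻¹) ^ (S.finite_act_le T).toFinset.card := by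
  classical
  set J := (S.finite_act_le T).toFinset
  let e : V × ℕ → V × ℕ × A.Q × (A.Msg → Bool) := fun j =>
    (j.1, j.2, A.stateAfter inp S (K.drive ρ) j.1 j.2, A.seen inp S (K.drive ρ) j.1 j.2)
  have he : Function.Injective e := by
    rintro ⟨v, i⟩ ⟨w, j⟩ h
    simp only [e, Prod.mk.injEq] at h
    exact Prod.ext h.1 h.2.1
  let t : V × ℕ × A.Q × (A.Msg → Bool) → Set (A.Q × A.Msg) := fun x => {K.drive ρ x}
  have hcyl := Measure.infinitePi_pi
    (fun x : V × ℕ × A.Q × (A.Msg → Bool) =>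
      (PMF.uniformOfFinset (A.τ x.2.2.1 x.2.2.2) (A.τ_nonempty _ _)).toMeasure)
    (s := J.image e) (t := t) (fun _ _ => MeasurableSet.of_discrete)
  have hprod : ∏ x ∈ J.image e,
      (PMF.uniformOfFinset (A.τ x.2.2.1 x.2.2.2) (A.τ_nonempty _ _)).toMeasure (t x) =
      ((Fintype.card R : ℝ≥0∞)⁻¹) ^ J.card := by
    rw [Finset.prod_image he.injOn, Finset.prod_congr rfl, Finset.prod_const]
    intro j _
    simp only [t]
    rw [PMF.toMeasure_apply_singleton _ _ MeasurableSet.of_discrete, PMF.uniformOfFinset_apply,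
      if_pos, K.card_τ]
    exact (K.mem_τ _ _ _).2 ⟨_, rfl⟩
  rw [← hprod, ← hcyl]
  refine measure_mono_ae ?_
  filter_upwards [A.ae_mem_τ V] with ω hω hev
  have heq := K.outcome_eq_drive hω hev
  intro x hx
  obtain ⟨⟨v, i⟩, hj, rfl⟩ := Finset.mem_image.1 (Finset.mem_coe.1 hx)
  have hT : S.act v i ≤ T := by simpa [J] using hj
  have ih' : ∀ u j, S.act u j < S.act v i →
      A.outcome inp S ω u j = A.outcome inp S (K.drive ρ) u j :=
    fun u j h => heq u j (h.le.trans hT)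
  have h1 := heq v i hT
  rw [outcome_eq, outcome_eq A inp S (K.drive ρ), stateAfter_congr ih', seen_congr ih'] at h1
  exact h1

open ENNReal in
/-- The coins of any finitely many activations are jointly uniform (upper bound). -/
theorem measure_coin_mem_le [Fintype R] [Nonempty R] {J : Type} [Fintype J] (inp : V → I)
    (S : Schedule N) (ι : J → V × ℕ) (hι : Function.Injective ι) (E : Finset (J → R)) :
    A.choiceMeasure V {ω | (fun j => K.coin (A.outcome inp S ω (ι j).1 (ι j).2)) ∈ E} ≤
      E.card * ((Fintype.card R : ℝ≥0∞)⁻¹) ^ Fintype.card J := by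
  classical
  obtain ⟨T, hT⟩ : ∃ T : ℝ, ∀ j, S.act (ι j).1 (ι j).2 ≤ T := by
    obtain ⟨T, hT⟩ := (Set.finite_range fun j => S.act (ι j).1 (ι j).2).bddAbove
    exact ⟨T, fun j => hT ⟨j, rfl⟩⟩
  set D := (S.finite_act_le T).toFinset with hD
  have hmem : ∀ v i, (v, i) ∈ D ↔ S.act v i ≤ T := by simp [D]
  let κ : J → D := fun j => ⟨ι j, by rw [hD]; simpa using hT j⟩
  have hκ : Function.Injective κ := fun a b h => hι (congrArg Subtype.val h)
  let r₀ : R := Classical.arbitrary R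
  -- To marginalize, sum over all coin assignments to the activations up to `T` whose restriction to
  -- the given ones lies in `E`.
  let E' : Finset (D → R) := Finset.univ.filter fun f => f ∘ κ ∈ E
  let ext : (D → R) → V → ℕ → R := fun f v i => if h : (v, i) ∈ D then f ⟨(v, i), h⟩ else r₀
  have hsub : {ω | (fun j => K.coin (A.outcome inp S ω (ι j).1 (ι j).2)) ∈ E} ⊆
      ⋃ f ∈ E', {ω | ∀ v i, S.act v i ≤ T → K.coin (A.outcome inp S ω v i) = ext f v i} := by
    intro ω hω
    simp only [Set.mem_iUnion]
    refine ⟨fun d => K.coin (A.outcome inp S ω d.1.1 d.1.2), ?_, ?_⟩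
    · simp only [E', Finset.mem_filter, Finset.mem_univ, true_and]
      exact hω
    · intro v i h
      simp [ext, (hmem v i).2 h]
  have hcard : E'.card = E.card * Fintype.card R ^ (D.card - Fintype.card J) := by
    let P : D → Prop := fun d => d ∈ Set.range κ
    let eq1 : J ≃ {d // P d} := Equiv.ofInjective κ hκ
    let eq2 : (D → R) ≃ (J → R) × ({d // ¬ P d} → R) :=
      (Equiv.piEquivPiSubtypeProd P fun _ => R).trans
        (Equiv.prodCongr (Equiv.arrowCongr eq1.symm (Equiv.refl R)) (Equiv.refl _))
    have h2 : ∀ f, (eq2 f).1 = f ∘ κ := by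
      intro f; funext j; rfl
    have : E'.map eq2.toEmbedding = E ×ˢ Finset.univ := by
      ext ⟨g, h⟩
      simp only [Finset.mem_map_equiv, Finset.mem_product, Finset.mem_univ, and_true]
      have := h2 (eq2.symm (g, h))
      rw [Equiv.apply_symm_apply] at this
      simp only [E', Finset.mem_filter, Finset.mem_univ, true_and]
      rw [← this]
    rw [← Finset.card_map eq2.toEmbedding, this, Finset.card_product, Finset.card_univ,
      Fintype.card_fun, Fintype.card_subtype_compl]
    congr 3
    · simp
    · exact (Fintype.card_congr eq1).symm
  have hJD : Fintype.card J ≤ D.card := by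
    have := Fintype.card_le_of_injective κ hκ
    simpa using this
  have hR0 : (Fintype.card R : ℝ≥0∞) ≠ 0 := by
    exact_mod_cast Fintype.card_ne_zero
  calc _ ≤ _ := measure_mono hsub
    _ ≤ ∑ f ∈ E', ((Fintype.card R : ℝ≥0∞)⁻¹) ^ D.card :=
      (measure_biUnion_finset_le _ _).trans
        (Finset.sum_le_sum fun f _ => K.measure_coin_eq_le_of_time inp S T (ext f))
    _ = _ := by
      rw [Finset.sum_const, nsmul_eq_mul, hcard]
      obtain ⟨m, hm⟩ := Nat.exists_eq_add_of_le hJD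
      rw [hm, Nat.add_sub_cancel_left, pow_add]
      push_cast
      have h1 : (Fintype.card R : ℝ≥0∞) ^ m * ((Fintype.card R : ℝ≥0∞)⁻¹) ^ m = 1 := by
        rw [← mul_pow, ENNReal.mul_inv_cancel hR0 (by simp), one_pow]
      rw [mul_assoc, mul_left_comm (_ ^ m), h1, mul_one]

end CoinRule

end SAAlgorithm

/-! ### Pulses of the synchronizer, as a function of the schedule -/

theorem Network.Nbr.symm {V : Type} {N : Network V} {u v : V} (h : N.Nbr u v) : N.Nbr v u := by
  rcases h with h | ⟨rfl, h⟩
  · exact Or.inl h.symm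
  · exact Or.inr ⟨rfl, h⟩

namespace Schedule

variable {V : Type} {N : Network V}

open Classical in
/-- The pulse reached by `v` after its activation number `i`, when every node starts in pulse `1`
and moves on as soon as all its ports show messages that are not older than its own pulse (an
empty port shows pulse `0`). -/
noncomputable def pulse [Finite V] (S : Schedule N) (v : V) (i : ℕ) : ℕ :=
  let p : ℕ :=
    match i with
    | 0 => 1
    | i' + 1 => pulse S v i'
  let port (u : V) (_hu : N.Nbr u v) : ℕ :=
    if _h : (S.delivered u v (S.act v i)).Nonempty then
      pulse S u (sSup (S.delivered u v (S.act v i)))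
    else 0
  p + (decide (∀ (u : V) (hu : N.Nbr u v), p ≤ port u hu)).toNat
termination_by S.rank v i
decreasing_by
  · exact S.rank_lt (S.act_strictMono v (Nat.lt_succ_self _))
  · exact S.rank_lt (S.act_sSup_delivered_lt (by assumption) (by assumption))

variable [Finite V]

/-- The pulse of `v` before its activation number `i`. -/
noncomputable def pulseBefore (S : Schedule N) (v : V) : ℕ → ℕ
  | 0 => 1
  | i + 1 => S.pulse v i

open Classical in
/-- The pulse of the message in the port of `v` for `u` at activation number `i` of `v`. -/
noncomputable def portPulse (S : Schedule N) (u v : V) (i : ℕ) : ℕ :=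
  if (S.delivered u v (S.act v i)).Nonempty then
    S.pulse u (sSup (S.delivered u v (S.act v i)))
  else 0

open Classical in
theorem pulse_eq (S : Schedule N) (v : V) (i : ℕ) :
    S.pulse v i = if ∀ u, N.Nbr u v → S.pulseBefore v i ≤ S.portPulse u v i
      then S.pulseBefore v i + 1 else S.pulseBefore v i := by
  have key : ∀ (p : ℕ) (P : Prop) [Decidable P],
      p + (decide P).toNat = if P then p + 1 else p := by
    intro p P _; split_ifs with h <;> simp [h]
  rw [pulse.eq_def]
  cases i <;> simp only [pulseBefore, portPulse, key] <;> congr!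

theorem pulseBefore_le_pulse (S : Schedule N) (v : V) (i : ℕ) :
    S.pulseBefore v i ≤ S.pulse v i := by
  rw [pulse_eq]; split_ifs <;> omega

theorem pulse_le_succ (S : Schedule N) (v : V) (i : ℕ) :
    S.pulse v i ≤ S.pulseBefore v i + 1 := by
  rw [pulse_eq]; split_ifs <;> omega

theorem pulse_mono (S : Schedule N) (v : V) : Monotone (S.pulse v) :=
  monotone_nat_of_le_succ fun i => S.pulseBefore_le_pulse v (i + 1)

theorem pulse_le_pulseBefore (S : Schedule N) {v : V} {i j : ℕ} (h : i < j) :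
    S.pulse v i ≤ S.pulseBefore v j := by
  obtain ⟨m, rfl⟩ := Nat.exists_eq_add_of_lt h
  exact S.pulse_mono v (by omega)

theorem pulseBefore_mono (S : Schedule N) (v : V) : Monotone (S.pulseBefore v) :=
  monotone_nat_of_le_succ fun i => S.pulseBefore_le_pulse v i

theorem one_le_pulseBefore (S : Schedule N) (v : V) (i : ℕ) : 1 ≤ S.pulseBefore v i :=
  S.pulseBefore_mono v (Nat.zero_le i)

omit [Finite V] in
theorem delivered_bddAbove (S : Schedule N) {u v : V} (h : N.Nbr u v) (t : ℝ) :
    BddAbove (S.delivered u v t) := by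
  obtain ⟨B, hB⟩ := ((S.act_tendsto u).eventually_gt_atTop t).exists_forall_of_atTop
  refine ⟨B, fun j hj => ?_⟩
  by_contra hlt
  have h1 := hB j (by omega)
  have h2 := S.act_lt_del u v h j
  have h3 : S.del u j v ≤ t := hj
  linarith

theorem pulse_le_portPulse (S : Schedule N) {u v : V} (h : N.Nbr u v) {i j : ℕ}
    (hd : S.del u j v ≤ S.act v i) : S.pulse u j ≤ S.portPulse u v i := by
  have hne : (S.delivered u v (S.act v i)).Nonempty := ⟨j, hd⟩
  rw [portPulse, if_pos hne]
  exact S.pulse_mono u (le_csSup (S.delivered_bddAbove h _) hd)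

theorem portPulse_mono (S : Schedule N) {u v : V} (h : N.Nbr u v) : Monotone (S.portPulse u v) := by
  intro i j hij
  rw [portPulse]
  split_ifs with hne
  · refine S.pulse_le_portPulse h ?_
    have : S.del u _ v ≤ S.act v i := S.sSup_delivered_mem h hne
    exact this.trans ((S.act_strictMono v).monotone hij)
  · exact Nat.zero_le _

theorem pulseBefore_le_portPulse_succ (S : Schedule N) {u v : V} (h : N.Nbr u v) (i : ℕ) :
    S.pulseBefore v i ≤ S.portPulse u v i + 1 := by
  induction i with
  | zero => simp [pulseBefore]
  | succ i ih =>
    have hm : S.portPulse u v i ≤ S.portPulse u v (i + 1) := S.portPulse_mono h (Nat.le_succ i)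
    change S.pulse v i ≤ _
    rw [pulse_eq]
    split_ifs with hc
    · have := hc u h
      omega
    · omega

/-- To leave a pulse, `u` needs a message of at least that pulse from `v`, which `v` sent strictly
earlier. So `u` is never more than one pulse ahead. -/
theorem pulse_le_of_act_lt (S : Schedule N) {u v : V} (h : N.Nbr u v) {i : ℕ} (j : ℕ)
    (hlt : S.act u j < S.act v i) : S.pulse u j ≤ S.pulseBefore v i + 1 := by
  induction j with
  | zero =>
    have h1 := S.pulse_le_succ u 0
    have h2 := S.one_le_pulseBefore v i
    simp only [pulseBefore] at h1
    omega
  | succ j ih =>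
    have ih := ih ((S.act_strictMono u (Nat.lt_succ_self j)).trans hlt)
    rw [pulse_eq]
    change S.pulseBefore u (j + 1) ≤ _ at ih
    split_ifs with hc
    · have h1 := hc v h.symm
      refine Nat.succ_le_succ (h1.trans ?_)
      rw [portPulse]
      split_ifs with hne
      · refine S.pulse_le_pulseBefore ?_
        have h2 := S.act_sSup_delivered_lt h.symm hne
        exact (S.act_strictMono v).lt_iff_lt.1 (h2.trans hlt)
      · exact Nat.zero_le _
    · exact ih

theorem portPulse_le (S : Schedule N) {u v : V} (h : N.Nbr u v) (i : ℕ) :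
    S.portPulse u v i ≤ S.pulseBefore v i + 1 := by
  rw [portPulse]
  split_ifs with hne
  · exact S.pulse_le_of_act_lt h _ (S.act_sSup_delivered_lt h hne)
  · exact Nat.zero_le _

theorem pulse_ge_of_delivered (S : Schedule N) {p : ℕ} {v : V} {i : ℕ}
    (hself : p ≤ S.pulseBefore v i)
    (h : ∀ u, N.Nbr u v → ∃ j, p ≤ S.pulse u j ∧ S.del u j v ≤ S.act v i) :
    p + 1 ≤ S.pulse v i := by
  by_cases hp : p + 1 ≤ S.pulseBefore v i
  · exact hp.trans (S.pulseBefore_le_pulse v i)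
  · rw [pulse_eq, if_pos]
    · omega
    · intro u hu
      obtain ⟨j, hj, hd⟩ := h u hu
      have := S.pulse_le_portPulse hu hd
      omega

/-- Each pulse costs at most `2 * b`: messages of the previous pulse arrive within `b`, and the next
activation follows within another `b`. -/
theorem BoundedBy.pulse_ge {S : Schedule N} {b : ℝ} (hb : S.BoundedBy b) (p : ℕ) (v : V) :
    ∃ j, S.act v j ≤ (2 * p + 1) * b ∧ p + 1 ≤ S.pulse v j := by
  have hb0 : 0 < b := (S.act_pos v).trans_le (hb.1 v)
  induction p generalizing v with
  | zero =>
    refine ⟨0, by simpa using hb.1 v, ?_⟩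
    exact S.pulseBefore_le_pulse v 0
  | succ p ih =>
    set T : ℝ := (2 * p + 1) * b
    have hT : 0 < T := by positivity
    have hex : ∃ j, T + b < S.act v j := ((S.act_tendsto v).eventually_gt_atTop _).exists
    classical
    refine ⟨Nat.find hex, ?_, ?_⟩
    · have hT2 : (2 * ((p + 1 : ℕ) : ℝ) + 1) * b = T + 2 * b := by
        push_cast; simp only [T]; ring
      rw [hT2]
      rcases hj : Nat.find hex with _ | j
      · linarith [hb.1 v]
      · have h1 : ¬ T + b < S.act v j := Nat.find_min hex (by omega)
        linarith [hb.2.1 v j, not_lt.1 h1]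
    · have hlt := Nat.find_spec hex
      refine S.pulse_ge_of_delivered ?_ fun u hu => ?_
      · obtain ⟨j, hj, hp⟩ := ih v
        refine hp.trans (S.pulse_le_pulseBefore ((S.act_strictMono v).lt_iff_lt.1 ?_))
        linarith
      · obtain ⟨j, hj, hp⟩ := ih u
        exact ⟨j, hp, by linarith [hb.2.2 u v hu j]⟩

/-- Progress also holds when the schedule has no finite time unit, as almost sure termination
requires. -/
theorem exists_pulse_ge (S : Schedule N) (p : ℕ) (v : V) : ∃ j, p ≤ S.pulse v j := by
  induction p generalizing v with
  | zero => exact ⟨0, Nat.zero_le _⟩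
  | succ p ih =>
    choose j hj using ih
    have h1 : ∀ᶠ i in atTop, ∀ u, S.del u (j u) v ≤ S.act v i :=
      eventually_all.2 fun u => (S.act_tendsto v).eventually_ge_atTop _
    obtain ⟨i, hi, hlt⟩ := (h1.and (eventually_gt_atTop (j v))).exists
    exact ⟨i, S.pulse_ge_of_delivered ((hj v).trans (S.pulse_le_pulseBefore hlt))
      fun u _ => ⟨j u, hj u, hi u⟩⟩

theorem lt_numAct (S : Schedule N) {v : V} {j : ℕ} {t : ℝ} (h : S.act v j ≤ t) :
    j < S.numAct v t := by
  have hfin : {i | S.act v i ≤ t}.Finite := by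
    refine ((S.finite_act_le t).preimage (f := fun i => (v, i)) ?_)
    exact fun a _ b _ h => (Prod.mk.inj h).2
  have hsub : (Set.Iic j) ⊆ {i | S.act v i ≤ t} := fun i hi =>
    ((S.act_strictMono v).monotone hi).trans h
  have := Set.ncard_le_ncard hsub hfin
  have hc : (Set.Iic j).ncard = j + 1 := by
    rw [← Finset.coe_Iic, Set.ncard_coe_finset, Nat.card_Iic]
  unfold numAct
  omega

/-- The activation in which `v` moves from pulse `t + 1` to pulse `t + 2`. -/
noncomputable def advance (S : Schedule N) (v : V) (t : ℕ) : ℕ := sInf {i | t + 2 ≤ S.pulse v i}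

theorem advance_eq (S : Schedule N) {v : V} {t i : ℕ} (h : S.pulseBefore v i = t + 1)
    (h' : S.pulse v i = t + 2) : S.advance v t = i := by
  refine le_antisymm (Nat.sInf_le h'.ge) (le_csInf ⟨i, h'.ge⟩ fun j hj => ?_)
  by_contra hlt
  have h1 := S.pulse_le_pulseBefore (v := v) (not_le.1 hlt)
  have h2 : t + 2 ≤ S.pulse v j := hj
  omega

theorem pulse_advance (S : Schedule N) (v : V) (t : ℕ) : S.pulse v (S.advance v t) = t + 2 := by
  have hmem : t + 2 ≤ S.pulse v (S.advance v t) := Nat.sInf_mem (S.exists_pulse_ge (t + 2) v)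
  refine le_antisymm ?_ hmem
  refine (S.pulse_le_succ v _).trans (Nat.succ_le_succ ?_)
  rcases h : S.advance v t with _ | i
  · simp [pulseBefore]
  · by_contra hlt
    have h1 : S.advance v t ≤ i := Nat.sInf_le (by simp only [pulseBefore, not_le] at hlt; exact hlt)
    omega

/-- Distinct rounds of a node consume coins of distinct activations. -/
theorem advance_injective (S : Schedule N) (v : V) : Function.Injective (S.advance v) := by
  intro s t h
  have h1 := S.pulse_advance v s
  have h2 := S.pulse_advance v t
  rw [h] at h1
  omega

end Schedule

/-! ### The alpha synchronizer simulates synchronous rounds -/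

/-- A finite-state algorithm for synchronous rounds, in which a node sees the set of the states of
its neighbors and tosses one coin per round. -/
structure RoundRule (I O St R : Type) where
  next : St → (St → Prop) → R → St
  init : I → St
  out : St → Option O
  out_next : ∀ s o, out s = some o → ∀ χ r, out (next s χ r) = some o

namespace RoundRule

/-- States and messages of the alpha synchronizer. -/
structure Pulsed (St R : Type) where
  pulse : ZMod 3
  prev : St
  cur : St
  coin : R

instance {St R : Type} [Finite St] [Finite R] : Finite (Pulsed St R) :=
  Finite.of_injective (fun q : Pulsed St R => (q.pulse, q.prev, q.cur, q.coin)) (by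
    rintro ⟨⟩ ⟨⟩ h
    simpa using h)

variable {I O St R V : Type} (B : RoundRule I O St R)

/-- The synchronous execution: `B.run N inp κ t v` is the state of `v` after `t` rounds. -/
def run (N : Network V) (inp : V → I) (κ : V → ℕ → R) : ℕ → V → St
  | 0, v => B.init (inp v)
  | t + 1, v => B.next (run N inp κ t v) (fun s => ∃ u, N.Nbr u v ∧ run N inp κ t u = s) (κ v t)

open Classical in
/-- One activation of the alpha synchronizer. -/
noncomputable def activate (q : Pulsed St R) (χ : Pulsed St R → Bool) (r : R) : Pulsed St R :=
  if ∃ σ, χ σ = true ∧ σ.pulse + 1 = q.pulse then ⟨q.pulse, q.prev, q.cur, r⟩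
  else ⟨q.pulse + 1, q.cur,
    B.next q.cur
      (fun s => ∃ σ, χ σ = true ∧ (if σ.pulse = q.pulse then σ.cur else σ.prev) = s) r, r⟩

theorem activate_coin (q : Pulsed St R) (χ : Pulsed St R → Bool) (r : R) :
    (B.activate q χ r).coin = r := by
  unfold activate
  split_ifs <;> rfl

/-- Residues mod 3 tell apart the three possible offsets -1, 0 and 1 between neighbors. -/
theorem natCast_add_one_eq_iff {x p : ℕ} (h : p ≤ x + 1) (h' : x ≤ p + 1) :
    (x : ZMod 3) + 1 = p ↔ x + 1 = p := by
  rw [← Nat.cast_add_one, ZMod.natCast_eq_natCast_iff']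
  omega

theorem natCast_eq_iff {x p : ℕ} (h : p ≤ x + 1) (h' : x ≤ p + 1) :
    (x : ZMod 3) = p ↔ x = p := by
  rw [ZMod.natCast_eq_natCast_iff']
  omega

/-- The state of `v` in pulse `p`, if it has drawn the coin `r` last. -/
def pulsedRun (N : Network V) (inp : V → I) (κ : V → ℕ → R) (v : V) (p : ℕ) (r : R) :
    Pulsed St R :=
  ⟨p, B.run N inp κ (p - 2) v, B.run N inp κ (p - 1) v, r⟩

/-- In pulse `p` a node has completed `p - 1` rounds. A neighbor in the same pulse shows the
required state as `cur`, and one that is a pulse ahead shows it as `prev`; a neighbor behind blocks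
the step. -/
theorem activate_pulsedRun {N : Network V} {inp : V → I} {κ : V → ℕ → R} {v : V} {p : ℕ}
    (hp : 1 ≤ p) (r r' : R) {χ : Pulsed St R → Bool} {port : V → Pulsed St R} {pp : V → ℕ}
    (hχ : ∀ σ, χ σ = true ↔ ∃ u, N.Nbr u v ∧ port u = σ)
    (hle : ∀ u, N.Nbr u v → p ≤ pp u + 1) (hge : ∀ u, N.Nbr u v → pp u ≤ p + 1)
    (hpulse : ∀ u, N.Nbr u v → (port u).pulse = (pp u : ZMod 3))
    (hcur : ∀ u, N.Nbr u v → 1 ≤ pp u → (port u).cur = B.run N inp κ (pp u - 1) u)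
    (hprev : ∀ u, N.Nbr u v → 1 ≤ pp u → (port u).prev = B.run N inp κ (pp u - 2) u) :
    ((∀ u, N.Nbr u v → p ≤ pp u) → r' = κ v (p - 1) →
      B.activate (B.pulsedRun N inp κ v p r) χ r' = B.pulsedRun N inp κ v (p + 1) r') ∧
    ((¬ ∀ u, N.Nbr u v → p ≤ pp u) →
      B.activate (B.pulsedRun N inp κ v p r) χ r' = B.pulsedRun N inp κ v p r') := by
  classical
  have hblock : (∃ σ, χ σ = true ∧ σ.pulse + 1 = (B.pulsedRun N inp κ v p r).pulse) ↔
      ¬ ∀ u, N.Nbr u v → p ≤ pp u := by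
    simp only [hχ, pulsedRun]
    push Not
    constructor
    · rintro ⟨_, ⟨u, hu, rfl⟩, h⟩
      refine ⟨u, hu, ?_⟩
      rw [hpulse u hu, natCast_add_one_eq_iff (hle u hu) (hge u hu)] at h
      omega
    · rintro ⟨u, hu, h⟩
      refine ⟨_, ⟨u, hu, rfl⟩, ?_⟩
      have := hle u hu
      rw [hpulse u hu, natCast_add_one_eq_iff this (hge u hu)]
      omega
  constructor
  · intro hc hr
    obtain ⟨t, rfl⟩ : ∃ t, p = t + 1 := ⟨p - 1, by omega⟩
    unfold activate
    rw [if_neg (by rw [hblock]; exact not_not.2 hc)]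
    have hset : (fun s => ∃ σ, χ σ = true ∧
        (if σ.pulse = (B.pulsedRun N inp κ v (t + 1) r).pulse then σ.cur else σ.prev) = s) =
        fun s => ∃ u, N.Nbr u v ∧ B.run N inp κ t u = s := by
      have hval : ∀ u, N.Nbr u v →
          (if (port u).pulse = (B.pulsedRun N inp κ v (t + 1) r).pulse
            then (port u).cur else (port u).prev) = B.run N inp κ t u := by
        intro u hu
        have h1 := hc u hu
        have h2 := hge u hu
        rw [hcur u hu (by omega), hprev u hu (by omega)]
        have h3 : (port u).pulse = (B.pulsedRun N inp κ v (t + 1) r).pulse ↔ pp u = t + 1 := by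
          rw [hpulse u hu]
          exact natCast_eq_iff (by omega) (by omega)
        simp only [h3]
        split_ifs with hh
        · rw [hh, Nat.add_sub_cancel]
        · have : pp u - 2 = t := by omega
          rw [this]
      funext s
      apply propext
      simp only [hχ]
      constructor
      · rintro ⟨_, ⟨u, hu, rfl⟩, h⟩
        exact ⟨u, hu, (hval u hu).symm.trans h⟩
      · rintro ⟨u, hu, h⟩
        exact ⟨_, ⟨u, hu, rfl⟩, (hval u hu).trans h⟩
    rw [hset]
    simp [pulsedRun, run, hr]
  · intro hc
    unfold activate
    rw [if_pos (hblock.2 hc)]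
    rfl

variable [Finite St] [Finite R] [Nonempty St] [Nonempty R]

/-- The asynchronous algorithm that simulates the rounds of `B`. -/
noncomputable def toSA : SAAlgorithm I O where
  Q := Pulsed St R
  Msg := Pulsed St R
  finite_Q := inferInstance
  finite_Msg := inferInstance
  τ q χ := (Set.toFinite (Set.range fun r => (B.activate q χ r, B.activate q χ r))).toFinset
  τ_nonempty q χ := by
    obtain ⟨r⟩ := ‹Nonempty R›
    exact ⟨(B.activate q χ r, B.activate q χ r), by simp⟩
  -- Pulse 1 with `prev = cur` fits the truncated subtraction in `pulsedRun`. The initial message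
  -- below has pulse 0, so an empty port blocks a node in pulse 1 and its dummy states are never
  -- read.
  input i := ⟨1, B.init i, B.init i, Classical.arbitrary R⟩
  output q := B.out q.cur
  σ₀ := ⟨0, Classical.arbitrary St, Classical.arbitrary St, Classical.arbitrary R⟩

theorem mem_τ_toSA (q : Pulsed St R) (χ : Pulsed St R → Bool) (p : Pulsed St R × Pulsed St R) :
    p ∈ B.toSA.τ q χ ↔ ∃ r, (B.activate q χ r, B.activate q χ r) = p :=
  Set.Finite.mem_toFinset _

theorem irrevocable_toSA : B.toSA.Irrevocable := by
  intro q o ho χ p hp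
  obtain ⟨r, rfl⟩ := (B.mem_τ_toSA q χ p).1 hp
  change B.out q.cur = some o at ho
  change B.out (B.activate q χ r).cur = some o
  unfold activate
  split_ifs
  · exact ho
  · exact B.out_next _ _ ho _ _

/-- The coins of the synchronizer. -/
noncomputable def coinRule : B.toSA.CoinRule R where
  step := fun q χ r => (B.activate q χ r, B.activate q χ r)
  coin := fun p => p.1.coin
  coin_step := fun q χ r => B.activate_coin q χ r
  mem_τ := B.mem_τ_toSA

variable [Finite V]

/-- The asynchronous run is the synchronous one read at the current pulse, where round `t` of `v`
uses the coin of the activation in which `v` completes that round. Coins of blocked activations are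
discarded. -/
theorem outcome_toSA {N : Network V} (inp : V → I) (S : Schedule N) (ρ : V → ℕ → R) (v : V)
    (i : ℕ) :
    B.toSA.outcome inp S (B.coinRule.drive ρ) v i =
      (B.pulsedRun N inp (fun v t => ρ v (S.advance v t)) v (S.pulse v i) (ρ v i),
       B.pulsedRun N inp (fun v t => ρ v (S.advance v t)) v (S.pulse v i) (ρ v i)) := by
  classical
  set κ : V → ℕ → R := fun v t => ρ v (S.advance v t) with hκ
  refine S.act_induction (P := fun v i => B.toSA.outcome inp S (B.coinRule.drive ρ) v i =
      (B.pulsedRun N inp κ v (S.pulse v i) (ρ v i), B.pulsedRun N inp κ v (S.pulse v i) (ρ v i)))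
    ?_ v i
  intro v i ih
  rw [SAAlgorithm.outcome_eq]
  change (B.activate _ _ _, B.activate _ _ _) = _
  set ω := B.coinRule.drive ρ
  set p := S.pulseBefore v i with hp
  have hp1 : 1 ≤ p := S.one_le_pulseBefore v i
  obtain ⟨r, hq⟩ : ∃ r, B.toSA.stateAfter inp S ω v i = B.pulsedRun N inp κ v p r := by
    rcases i with _ | i
    · refine ⟨Classical.arbitrary R, ?_⟩
      simp [SAAlgorithm.stateAfter, toSA, pulsedRun, hp, Schedule.pulseBefore, run]
    · refine ⟨ρ v i, ?_⟩
      simp only [SAAlgorithm.stateAfter]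
      rw [ih v i (S.act_strictMono v (Nat.lt_succ_self i))]
      rfl
  have hport : ∀ u, N.Nbr u v → (B.toSA.portAt inp S ω u v i).pulse = (S.portPulse u v i : ZMod 3) ∧
      (1 ≤ S.portPulse u v i →
        (B.toSA.portAt inp S ω u v i).cur = B.run N inp κ (S.portPulse u v i - 1) u ∧
        (B.toSA.portAt inp S ω u v i).prev = B.run N inp κ (S.portPulse u v i - 2) u) := by
    intro u hu
    unfold SAAlgorithm.portAt Schedule.portPulse
    split_ifs with hne
    · rw [ih _ _ (S.act_sSup_delivered_lt hu hne)]
      exact ⟨rfl, fun _ => ⟨rfl, rfl⟩⟩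
    · refine ⟨by simp [toSA], fun h => by omega⟩
  have hmain : B.activate (B.toSA.stateAfter inp S ω v i) (B.toSA.seen inp S ω v i) (ρ v i) =
      B.pulsedRun N inp κ v (S.pulse v i) (ρ v i) := by
    have key := B.activate_pulsedRun (κ := κ) (inp := inp) hp1 r (ρ v i)
      (χ := B.toSA.seen inp S ω v i) (port := fun u => B.toSA.portAt inp S ω u v i)
      (pp := fun u => S.portPulse u v i)
      (fun σ => by simp only [SAAlgorithm.seen, decide_eq_true_eq]; rfl)
      (fun u hu => S.pulseBefore_le_portPulse_succ hu i) (fun u hu => S.portPulse_le hu i)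
      (fun u hu => (hport u hu).1) (fun u hu h => ((hport u hu).2 h).1)
      (fun u hu h => ((hport u hu).2 h).2)
    rw [← hq] at key
    by_cases hc : ∀ u, N.Nbr u v → p ≤ S.portPulse u v i
    · have hpulse : S.pulse v i = p + 1 := by rw [S.pulse_eq, if_pos hc]
      rw [hpulse]
      refine key.1 hc ?_
      have hadv : S.advance v (p - 1) = i := S.advance_eq (by omega) (by omega)
      simp only [hκ, hadv]
    · have hpulse : S.pulse v i = p := by rw [S.pulse_eq, if_neg hc]
      rw [hpulse]
      exact key.2 hc
  exact Prod.ext hmain hmain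

theorem output_toSA {N : Network V} (inp : V → I) (S : Schedule N) (ρ : V → ℕ → R) (v : V)
    (m : ℕ) :
    B.toSA.output (B.toSA.stateAfter inp S (B.coinRule.drive ρ) v m) =
      B.out (B.run N inp (fun v t => ρ v (S.advance v t)) (S.pulseBefore v m - 1) v) := by
  rcases m with _ | i
  · rfl
  · simp only [SAAlgorithm.stateAfter]
    rw [B.outcome_toSA]
    rfl

end RoundRule

/-! ### Distance levels and wave counters -/

namespace Network

variable {V : Type} (N : Network V)

/-- The distance of a node to the closest candidate. -/
noncomputable def level (cand : V → Bool) (v : V) : ℕ :=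
  sInf {d | ∃ r, cand r = true ∧ N.graph.dist r v = d}

variable {N} {cand : V → Bool}

theorem exists_dist_eq_level (hc : ∃ r, cand r = true) (v : V) :
    ∃ r, cand r = true ∧ N.graph.dist r v = N.level cand v := by
  obtain ⟨r, hr⟩ := hc
  exact Nat.sInf_mem (s := {d | ∃ r, cand r = true ∧ N.graph.dist r v = d}) ⟨_, r, hr, rfl⟩

theorem level_le_dist {r : V} (hr : cand r = true) (v : V) :
    N.level cand v ≤ N.graph.dist r v :=
  Nat.sInf_le ⟨r, hr, rfl⟩

theorem level_eq_zero_iff (hG : N.graph.Connected) (hc : ∃ r, cand r = true) {v : V} :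
    N.level cand v = 0 ↔ cand v = true := by
  constructor
  · intro h
    obtain ⟨r, hr, hd⟩ := exists_dist_eq_level (N := N) hc v
    rw [h, hG.dist_eq_zero_iff] at hd
    exact hd ▸ hr
  · intro h
    simpa using level_le_dist (N := N) h v

theorem level_le_succ (hG : N.graph.Connected) (hc : ∃ r, cand r = true) {u v : V}
    (h : N.Nbr u v) : N.level cand u ≤ N.level cand v + 1 := by
  rcases h with h | ⟨rfl, _⟩
  · obtain ⟨r, hr, hd⟩ := exists_dist_eq_level (N := N) hc v
    have h1 := hG.dist_triangle (u := r) (v := v) (w := u)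
    rw [hd, SimpleGraph.dist_eq_one_iff_adj.2 h.symm] at h1
    exact (level_le_dist hr u).trans h1
  · exact Nat.le_succ _

theorem exists_parent (hG : N.graph.Connected) (hc : ∃ r, cand r = true) {v : V}
    (h : N.level cand v ≠ 0) : ∃ u, N.Nbr u v ∧ N.level cand u + 1 = N.level cand v := by
  obtain ⟨r, hr, hd⟩ := exists_dist_eq_level (N := N) hc v
  obtain ⟨p, hp⟩ := hG.exists_walk_length_eq_dist v r
  rw [SimpleGraph.dist_comm, hd] at hp
  cases p with
  | nil => exact absurd hp.symm h
  | @cons _ u _ hadj q =>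
    have hu : N.Nbr u v := Or.inl hadj.symm
    refine ⟨u, hu, ?_⟩
    rw [SimpleGraph.Walk.length_cons] at hp
    have h1 := level_le_dist (N := N) hr u
    have h2 : N.graph.dist r u ≤ q.length := by
      rw [SimpleGraph.dist_comm]; exact SimpleGraph.dist_le q
    have h3 := level_le_succ hG hc hu.symm
    omega

theorem level_le_diam [Finite V] (hG : N.graph.Connected) (hc : ∃ r, cand r = true) (v : V) :
    N.level cand v ≤ N.graph.diam := by
  obtain ⟨r, hr⟩ := hc
  have := hG.nonempty
  exact (level_le_dist hr v).trans
    (SimpleGraph.dist_le_diam (SimpleGraph.connected_iff_ediam_ne_top.1 hG))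

open Classical in
/-- The rule by which a node advances its counter: a node with counter `0` waits for a neighbor
with positive counter unless it is a candidate, and other nodes wait until no neighbor is behind,
and until all their parents (if the counter is even) or children (if it is odd) are ahead. -/
def Ready (N : Network V) (cand : V → Bool) (f : V → ℕ) (v : V) : Prop :=
  if f v = 0 then cand v = true ∨ ∃ u, N.Nbr u v ∧ 0 < f u
  else ∀ u, N.Nbr u v → f v ≤ f u ∧
    (Even (f v) → N.level cand u + 1 = N.level cand v → f v < f u) ∧
    (¬ Even (f v) → N.level cand u = N.level cand v + 1 → f v < f u)

open Classical in
/-- The counters after `t` rounds. -/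
noncomputable def count (N : Network V) (cand : V → Bool) : ℕ → V → ℕ
  | 0, _ => 0
  | t + 1, v => if N.Ready cand (count N cand t) v then count N cand t v + 1 else count N cand t v

theorem count_succ_of_ready {t : ℕ} {v : V} (h : N.Ready cand (N.count cand t) v) :
    N.count cand (t + 1) v = N.count cand t v + 1 := by
  rw [count, if_pos h]

theorem count_succ_of_not_ready {t : ℕ} {v : V} (h : ¬ N.Ready cand (N.count cand t) v) :
    N.count cand (t + 1) v = N.count cand t v := by
  rw [count, if_neg h]

theorem count_le_succ (t : ℕ) (v : V) : N.count cand (t + 1) v ≤ N.count cand t v + 1 := by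
  rw [count]; split_ifs <;> omega

theorem count_mono (v : V) : Monotone fun t => N.count cand t v := by
  refine monotone_nat_of_le_succ fun t => ?_
  simp only [count]
  split_ifs <;> omega

theorem le_of_ready {t : ℕ} {u v : V} (h : N.Ready cand (N.count cand t) v) (hu : N.Nbr u v) :
    N.count cand t v ≤ N.count cand t u := by
  rw [Ready] at h
  split_ifs at h with h0
  · rw [h0]; exact Nat.zero_le _
  · exact (h u hu).1

theorem count_le_of_nbr (t : ℕ) {u v : V} (hu : N.Nbr u v) :
    N.count cand t v ≤ N.count cand t u + 1 := by
  induction t with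
  | zero => simp only [count]; omega
  | succ t ih =>
    have h1 : N.count cand t u ≤ N.count cand (t + 1) u := count_mono u (Nat.le_succ t)
    by_cases h : N.Ready cand (N.count cand t) v
    · have := le_of_ready h hu
      rw [count_succ_of_ready h]
      omega
    · rw [count_succ_of_not_ready h]
      omega

/-- Leaving counter 0 is plain flooding from the candidates, so a node joins exactly when the BFS
front reaches it. -/
theorem count_pos_iff (hG : N.graph.Connected) (hc : ∃ r, cand r = true) (t : ℕ) (v : V) :
    0 < N.count cand t v ↔ N.level cand v < t := by
  induction t generalizing v with
  | zero =>
    simp [count]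
  | succ t ih =>
    by_cases h0 : 0 < N.count cand t v
    · have h1 : N.count cand t v ≤ N.count cand (t + 1) v := count_mono v (Nat.le_succ t)
      have := (ih v).1 h0
      constructor <;> intro <;> omega
    · have hR : N.Ready cand (N.count cand t) v ↔
          cand v = true ∨ ∃ u, N.Nbr u v ∧ 0 < N.count cand t u := by
        rw [Ready, if_pos (by omega)]
      have hl : ¬ N.level cand v < t := fun h => h0 ((ih v).2 h)
      constructor
      · intro h
        have : N.Ready cand (N.count cand t) v := by
          by_contra hn
          rw [count_succ_of_not_ready hn] at h
          exact h0 h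
        rcases hR.1 this with hv | ⟨u, hu, hp⟩
        · rw [(level_eq_zero_iff hG hc).2 hv]
          exact Nat.succ_pos t
        have h1 := (ih u).1 hp
        have h2 := level_le_succ hG hc hu.symm
        omega
      · intro h
        rw [count_succ_of_ready]
        · omega
        · by_cases hv : N.level cand v = 0
          · exact hR.2 (Or.inl ((level_eq_zero_iff hG hc).1 hv))
          · obtain ⟨u, hu, hl'⟩ := exists_parent hG hc hv
            exact hR.2 (Or.inr ⟨u, hu, (ih u).2 (by omega)⟩)

/-- At counter 0 this is not part of `Ready`: there it holds because flooding reaches all parents of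
a node in the same round. -/
theorem lt_of_ready_of_even (hG : N.graph.Connected) (hc : ∃ r, cand r = true) {t : ℕ} {u v : V}
    (h : N.Ready cand (N.count cand t) v) (he : Even (N.count cand t v)) (hu : N.Nbr u v)
    (hl : N.level cand u + 1 = N.level cand v) : N.count cand t v < N.count cand t u := by
  rw [Ready] at h
  split_ifs at h with h0
  · rcases h with hv | ⟨w, hw, hp⟩
    · have := (level_eq_zero_iff hG hc).2 hv
      omega
    rw [h0, count_pos_iff hG hc]
    rw [count_pos_iff hG hc] at hp
    have := level_le_succ hG hc hw.symm
    omega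
  · exact (h u hu).2.1 he hl

theorem lt_of_ready_of_odd {t : ℕ} {u v : V}
    (h : N.Ready cand (N.count cand t) v) (he : ¬ Even (N.count cand t v)) (hu : N.Nbr u v)
    (hl : N.level cand u = N.level cand v + 1) : N.count cand t v < N.count cand t u := by
  rw [Ready, if_neg (fun h0 => he (by rw [h0]; exact Even.zero))] at h
  exact (h u hu).2.2 he hl

/-- Once all counters are at least `q`, the next step sweeps through the layers, one layer per
round: from the candidates outward for even `q`, from the farthest layer inward for odd `q`. -/
theorem le_count (hG : N.graph.Connected) (hc : ∃ r, cand r = true) {D : ℕ}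
    (hD : ∀ v, N.level cand v ≤ D) (q : ℕ) (v : V) : q ≤ N.count cand (q * (D + 1)) v := by
  induction q generalizing v with
  | zero => exact Nat.zero_le _
  | succ q ih =>
    set s := q * (D + 1) with hs
    have hs' : (q + 1) * (D + 1) = s + (D + 1) := by rw [hs]; ring
    have hq : ∀ (l : ℕ) (v : V), q ≤ N.count cand (s + l) v := fun l v =>
      (ih v).trans (count_mono v (Nat.le_add_right s l))
    -- a node that is still at `q` advances if its parents and children permit
    have step : ∀ l v, (Even q → ∀ u, N.Nbr u v → N.level cand u + 1 = N.level cand v →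
          q < N.count cand (s + l) u) →
        (¬ Even q → ∀ u, N.Nbr u v → N.level cand u = N.level cand v + 1 →
          q < N.count cand (s + l) u) → q ≠ 0 → q < N.count cand (s + l + 1) v := by
      intro l v he ho hq0
      have h1 := hq l v
      have h2 : N.count cand (s + l) v ≤ N.count cand (s + l + 1) v :=
        count_mono v (Nat.le_succ _)
      by_cases hlt : q < N.count cand (s + l) v
      · omega
      · have heq : N.count cand (s + l) v = q := by omega
        rw [count_succ_of_ready]
        · omega
        · rw [Ready, heq, if_neg hq0]
          exact fun u hu => ⟨hq l u, fun h => he h u hu, fun h => ho h u hu⟩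
    rw [hs']
    rcases Nat.eq_zero_or_pos q with h0 | hpos
    · have h1 : 0 < N.count cand (s + (D + 1)) v := by
        rw [count_pos_iff hG hc]
        have := hD v
        omega
      omega
    · by_cases he : Even q
      · have key : ∀ l v, N.level cand v ≤ l → q < N.count cand (s + l + 1) v := by
          intro l
          induction l with
          | zero =>
            intro v hv
            refine step 0 v (fun _ u hu hl => ?_) (fun h => absurd he h) hpos.ne'
            omega
          | succ l ih =>
            intro v hv
            refine step (l + 1) v (fun _ u hu hl => ?_) (fun h => absurd he h) hpos.ne'
            exact ih u (by omega)
        exact key D v (hD v)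
      · have key : ∀ l v, D ≤ N.level cand v + l → q < N.count cand (s + l + 1) v := by
          intro l
          induction l with
          | zero =>
            intro v hv
            refine step 0 v (fun h => absurd h he) (fun _ u hu hl => ?_) hpos.ne'
            have := hD u
            omega
          | succ l ih =>
            intro v hv
            refine step (l + 1) v (fun h => absurd h he) (fun _ u hu hl => ?_) hpos.ne'
            exact ih u (by omega)
        exact key D v (by omega)

/-! ### Spread of information by the waves of a block -/

/-- `N.Reach cand x j v`: the waves carry the information of `x` to `v` by the time that the
counter of `v` has advanced `j` times since the beginning of the block. -/
inductive Reach (N : Network V) (cand : V → Bool) (x : V) : ℕ → V → Prop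
  | start : Reach N cand x 0 x
  | stay {j v} : Reach N cand x j v → Reach N cand x (j + 1) v
  | nbr {j u v} : Reach N cand x j u → N.Nbr u v → Reach N cand x (j + 1) v
  | down {j u v} : Even j → Reach N cand x (j + 1) u → N.Nbr u v →
      N.level cand u + 1 = N.level cand v → Reach N cand x (j + 1) v
  | up {j u v} : ¬ Even j → Reach N cand x (j + 1) u → N.Nbr u v →
      N.level cand u = N.level cand v + 1 → Reach N cand x (j + 1) v

/-- `u` is a parent of `v`. -/
def Parent (N : Network V) (cand : V → Bool) (u v : V) : Prop :=
  N.Nbr u v ∧ N.level cand u + 1 = N.level cand v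

theorem exists_root (hG : N.graph.Connected) (hc : ∃ r, cand r = true) (v : V) :
    ∃ r, cand r = true ∧ Relation.ReflTransGen (N.Parent cand) r v := by
  generalize hl : N.level cand v = l
  induction l generalizing v with
  | zero => exact ⟨v, (level_eq_zero_iff hG hc).1 hl, .refl⟩
  | succ l ih =>
    obtain ⟨u, hu, hul⟩ := exists_parent hG hc (v := v) (by omega)
    obtain ⟨r, hr, hru⟩ := ih u (by omega)
    exact ⟨r, hr, hru.tail ⟨hu, hul⟩⟩

theorem Reach.descend {x : V} {j : ℕ} {u v : V} (hj : Even j) (h : N.Reach cand x (j + 1) u)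
    (huv : Relation.ReflTransGen (N.Parent cand) u v) : N.Reach cand x (j + 1) v := by
  induction huv with
  | refl => exact h
  | tail _ hp ih => exact .down hj ih hp.1 hp.2

theorem Reach.ascend {x : V} {j : ℕ} {u v : V} (hj : ¬ Even j) (h : N.Reach cand x (j + 1) v)
    (huv : Relation.ReflTransGen (N.Parent cand) u v) : N.Reach cand x (j + 1) u := by
  induction huv using Relation.ReflTransGen.head_induction_on with
  | refl => exact h
  | head hp _ ih => exact .up hj ih hp.1.symm hp.2.symm

theorem root_unique (hG : N.graph.Connected) (hc : ∃ r, cand r = true) {r v : V}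
    (hv : cand v = true) (h : Relation.ReflTransGen (N.Parent cand) r v) : r = v := by
  cases h with
  | refl => rfl
  | tail _ hp =>
    have := hp.2
    rw [(level_eq_zero_iff hG hc).2 hv] at this
    omega

/-- After `k` waves down and up and one more wave down, all the information is everywhere, if there
are at most `k` candidates. -/
theorem reach_all [Fintype V] (hG : N.graph.Connected) (hc : ∃ r, cand r = true) {k : ℕ}
    (hk : (Finset.univ.filter fun v => cand v = true).card ≤ k) (x v : V) :
    N.Reach cand x (2 * k + 1) v := by
  classical
  set roots := Finset.univ.filter fun v => cand v = true with hroots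
  let I : ℕ → Finset V := fun i => roots.filter fun r => N.Reach cand x (2 * i) r
  have hodd : ∀ i, ¬ Even (2 * i + 1) := fun i => by simp
  have hmono : ∀ i, I i ⊆ I (i + 1) := by
    intro i r hr
    simp only [I, Finset.mem_filter] at hr ⊢
    exact ⟨hr.1, hr.2.stay.stay⟩
  have hall : ∀ i, I i = roots → ∀ v, N.Reach cand x (2 * i + 1) v := by
    intro i hi v
    obtain ⟨r, hr, hrv⟩ := exists_root hG hc v
    have : r ∈ I i := by rw [hi]; simpa [hroots] using hr
    simp only [I, Finset.mem_filter] at this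
    exact Reach.descend (by simp) this.2.stay hrv
  -- If no new candidate is informed, the nodes below informed candidates are closed under
  -- adjacency: a neighbor `b` of such a node hears from it, and the upward wave informs a candidate
  -- above `b`, which must have been informed already. By connectedness every node lies below an
  -- informed candidate, and a candidate lies only below itself.
  have hgrow : ∀ i, (I i).Nonempty → I (i + 1) ⊆ I i → I i = roots := by
    intro i ⟨r₀, hr₀⟩ hsub
    have hW : ∀ v, ∃ r ∈ I i, Relation.ReflTransGen (N.Parent cand) r v := by
      intro v
      obtain ⟨p⟩ := hG.preconnected r₀ v
      have key : ∀ {a b : V} (_ : N.graph.Walk a b),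
          (∃ r ∈ I i, Relation.ReflTransGen (N.Parent cand) r a) →
          ∃ r ∈ I i, Relation.ReflTransGen (N.Parent cand) r b := by
        intro a b p
        induction p with
        | nil => exact id
        | @cons a b _ hadj _ ih =>
          rintro ⟨r, hr, hra⟩
          apply ih
          simp only [I, Finset.mem_filter] at hr
          have h1 : N.Reach cand x (2 * i + 1) a := Reach.descend (by simp) hr.2.stay hra
          have h2 : N.Reach cand x (2 * i + 1 + 1) b := .nbr h1 (Or.inl hadj)
          obtain ⟨r', hr', hrb⟩ := exists_root hG hc b
          refine ⟨r', hsub ?_, hrb⟩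
          simp only [I, Finset.mem_filter]
          exact ⟨by simpa [hroots] using hr', Reach.ascend (hodd i) h2 hrb⟩
      exact key p ⟨r₀, hr₀, .refl⟩
    refine Finset.Subset.antisymm (Finset.filter_subset _ _) fun r hr => ?_
    obtain ⟨r', hr', h⟩ := hW r
    rw [← root_unique hG hc (by simpa [hroots] using hr) h]
    exact hr'
  -- The first upward wave informs a candidate above `x`; afterwards each down-up pair adds at least
  -- one more until none is missing.
  have hcard : ∀ i, I (i + 1) = roots ∨ i + 1 ≤ (I (i + 1)).card := by
    intro i
    induction i with
    | zero =>
      right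
      obtain ⟨r, hr, hrx⟩ := exists_root hG hc x
      refine Finset.card_pos.2 ⟨r, ?_⟩
      simp only [I, Finset.mem_filter]
      exact ⟨by simpa [hroots] using hr,
        Reach.ascend (hodd 0) (Reach.stay (Reach.stay Reach.start)) hrx⟩
    | succ i ih =>
      rcases ih with h | h
      · left
        exact Finset.Subset.antisymm (Finset.filter_subset _ _) (h ▸ hmono (i + 1))
      · by_cases hsub : I (i + 1 + 1) ⊆ I (i + 1)
        · left
          have := hgrow (i + 1) (Finset.card_pos.1 (by omega)) hsub
          exact Finset.Subset.antisymm (Finset.filter_subset _ _) (this ▸ hmono (i + 1))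
        · right
          have := Finset.card_lt_card (⟨hmono (i + 1), hsub⟩ : I (i + 1) ⊂ I (i + 1 + 1))
          omega
  obtain ⟨r, hr⟩ := hc
  have hk0 : 0 < k := lt_of_lt_of_le (Finset.card_pos.2 ⟨r, by simpa [hroots] using hr⟩) hk
  obtain ⟨i, rfl⟩ : ∃ i, k = i + 1 := ⟨k - 1, by omega⟩
  refine hall _ ?_ v
  rcases hcard i with h | h
  · exact h
  · exact Finset.eq_of_subset_of_card_le (Finset.filter_subset _ _) (hk.trans h)

end Network

/-! ### The synchronous election algorithm and its invariant -/

/-- The part of the state of a node that takes part in the election. -/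
structure Core (L : ℕ) where
  alive : Bool
  timer : Bool
  color : Fin (L + 1)
  decision : Option Bool

namespace Core

variable {L : ℕ}

/-- What a node contributes to the information of a block: its color if it is an alive candidate,
and `none` if its timer is running. -/
def Contributes (c : Core L) (o : Option (Fin (L + 1))) : Prop :=
  match o with
  | none => c.timer = true
  | some x => c.alive = true ∧ c.color = x

open Classical in
/-- The transition at the end of a block with information `Y`, with fresh coin `r`. -/
noncomputable def update (c : Core L) (Y : Set (Option (Fin (L + 1)))) (r : Fin (L + 1) × Bool) :
    Core L where
  alive := c.alive && decide (∀ x, some x ∈ Y → x ≤ c.color)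
  timer := c.timer && r.2
  color := r.1
  decision :=
    match c.decision with
    | some d => some d
    | none =>
      if none ∈ Y then none else some (c.alive && decide (∀ x, some x ∈ Y → x ≤ c.color))

/-- The states at the beginning of the blocks. -/
noncomputable def logic {V : Type} (cand : V → Bool) (θ : V → ℕ → Fin (L + 1) × Bool) :
    ℕ → V → Core L
  | 0, v => ⟨cand v, true, 0, none⟩
  | m + 1, v => (logic cand θ m v).update {o | ∃ u, (logic cand θ m u).Contributes o} (θ v m)

end Core

/-- The states of the synchronous leader selection algorithm. -/
structure ElectState (k L : ℕ) where
  joined : Bool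
  lev : ZMod 3
  cnt : ZMod (3 * (2 * k + 2))
  info : Set (Option (Fin (L + 1)))
  core : Core L

namespace ElectState

variable {k L : ℕ}

instance : Finite (Core L) :=
  Finite.of_injective (fun c : Core L => (c.alive, c.timer, c.color, c.decision)) (by
    rintro ⟨⟩ ⟨⟩ h
    simpa using h)

instance : NeZero (3 * (2 * k + 2)) := ⟨by omega⟩

instance : Finite (ElectState k L) :=
  Finite.of_injective (fun s : ElectState k L => (s.joined, s.lev, s.cnt, s.info, s.core)) (by
    rintro ⟨⟩ ⟨⟩ h
    simpa using h)

instance : Nonempty (ElectState k L) := ⟨⟨true, 0, 0, ∅, ⟨true, true, 0, none⟩⟩⟩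

/-- The finite-state version of `Network.Ready`. -/
def Advances (s : ElectState k L) (χ : ElectState k L → Prop) : Prop :=
  if s.joined = true then
    ∀ σ, χ σ → (σ.joined = true ∧ σ.cnt + 1 ≠ s.cnt) ∧
      (Even s.cnt.val → σ.lev + 1 = s.lev → σ.cnt = s.cnt + 1) ∧
      (¬ Even s.cnt.val → σ.lev = s.lev + 1 → σ.cnt = s.cnt + 1)
  else s.core.alive = true ∨ ∃ σ, χ σ ∧ σ.joined = true

open Classical in
/-- The level of a node that joins now. -/
noncomputable def joinLevel (s : ElectState k L) (χ : ElectState k L → Prop) : ZMod 3 :=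
  if s.core.alive = true then 0 else if h : ∃ σ, χ σ ∧ σ.joined = true then h.choose.lev + 1 else 0

open Classical in
/-- One round of the leader selection algorithm. -/
noncomputable def next (s : ElectState k L) (χ : ElectState k L → Prop)
    (r : Fin (L + 1) × Bool) : ElectState k L :=
  if s.Advances χ then
    if (s.cnt.val + 1) % (2 * k + 2) = 0 then
      { joined := true
        lev := if s.joined = true then s.lev else s.joinLevel χ
        cnt := s.cnt + 1
        info := {o | (s.core.update s.info r).Contributes o}
        core := s.core.update s.info r }
    else
      { joined := true
        lev := if s.joined = true then s.lev else s.joinLevel χ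
        cnt := s.cnt + 1
        info := s.info ∪ {o | ∃ σ, χ σ ∧ o ∈ σ.info}
        core := s.core }
  else s

variable (k L) in
/-- The synchronous leader selection algorithm. -/
noncomputable def rule : RoundRule Bool Bool (ElectState k L) (Fin (L + 1) × Bool) where
  next := next
  init i := ⟨false, 0, 0, {o | (⟨i, true, 0, none⟩ : Core L).Contributes o}, ⟨i, true, 0, none⟩⟩
  out s := s.core.decision
  out_next := by
    intro s o ho χ r
    unfold next
    by_cases h1 : s.Advances χ
    · rw [if_pos h1]
      by_cases h2 : (s.cnt.val + 1) % (2 * k + 2) = 0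
      · rw [if_pos h2]
        simp only [Core.update, ho]
      · rw [if_neg h2]
        exact ho
    · rw [if_neg h1]
      exact ho

theorem cast_val (n : ℕ) : ((n : ZMod (3 * (2 * k + 2))).val) = n % (3 * (2 * k + 2)) :=
  ZMod.val_natCast _ n

theorem cast_mod (n : ℕ) : (n % (3 * (2 * k + 2)) + 1) % (2 * k + 2) = (n + 1) % (2 * k + 2) := by
  rw [Nat.add_mod, Nat.mod_mod_of_dvd _ (Dvd.intro_left 3 rfl), ← Nat.add_mod]

theorem cast_even (n : ℕ) : Even (n % (3 * (2 * k + 2))) ↔ Even n := by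
  rw [Nat.even_iff, Nat.even_iff, Nat.mod_mod_of_dvd]
  exact ⟨3 * (k + 1), by ring⟩

/-- The modulus is a multiple of the block length and even, so block ends and parity survive
reduction; the factor 3 keeps it above 2 for every `k`, enough to compare neighboring counters. -/
theorem cast_eq_iff {x p : ℕ} (h : p ≤ x + 2) (h' : x ≤ p + 2) :
    (x : ZMod (3 * (2 * k + 2))) = p ↔ x = p := by
  constructor
  · intro hh
    rw [ZMod.natCast_eq_natCast_iff] at hh
    rcases le_total x p with hxp | hxp
    · have := (Nat.modEq_iff_dvd' hxp).1 hh
      rcases Nat.eq_zero_or_pos (p - x) with h0 | h0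
      · omega
      · have := Nat.le_of_dvd h0 this
        omega
    · have := (Nat.modEq_iff_dvd' hxp).1 hh.symm
      rcases Nat.eq_zero_or_pos (x - p) with h0 | h0
      · omega
      · have := Nat.le_of_dvd h0 this
        omega
  · rintro rfl; rfl

variable {V : Type} {N : Network V} {cand : V → Bool}

/-- The round in which `v` passes from block `m` to block `m + 1`. -/
noncomputable def blockEnd (k : ℕ) (N : Network V) (cand : V → Bool) (v : V) (m : ℕ) : ℕ :=
  sInf {t | (m + 1) * (2 * k + 2) ≤ N.count cand (t + 1) v}

theorem blockEnd_eq {v : V} {m t : ℕ} (h : N.count cand t v < (m + 1) * (2 * k + 2))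
    (h' : (m + 1) * (2 * k + 2) ≤ N.count cand (t + 1) v) : blockEnd k N cand v m = t := by
  refine le_antisymm (Nat.sInf_le h') (le_csInf ⟨t, h'⟩ fun s hs => ?_)
  by_contra hlt
  have h1 : N.count cand (s + 1) v ≤ N.count cand t v := Network.count_mono v (by omega)
  have h2 : (m + 1) * (2 * k + 2) ≤ N.count cand (s + 1) v := hs
  omega

theorem count_blockEnd [Finite V] (hG : N.graph.Connected) (hc : ∃ r, cand r = true) (v : V)
    (m : ℕ) : N.count cand (blockEnd k N cand v m + 1) v = (m + 1) * (2 * k + 2) := by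
  set T := (m + 1) * (2 * k + 2) with hT
  have hT2 : 2 ≤ T := by rw [hT]; nlinarith
  have hex : {t | T ≤ N.count cand (t + 1) v}.Nonempty := by
    refine ⟨T * (N.graph.diam + 1), ?_⟩
    exact (Network.le_count hG hc (Network.level_le_diam hG hc) T v).trans
      (Network.count_mono v (Nat.le_succ _))
  have hmem : T ≤ N.count cand (blockEnd k N cand v m + 1) v := Nat.sInf_mem hex
  refine le_antisymm ?_ hmem
  refine (Network.count_le_succ _ v).trans ?_
  rcases h : blockEnd k N cand v m with _ | t
  · have : N.count cand 0 v = 0 := rfl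
    omega
  · by_contra hlt
    have h1 : blockEnd k N cand v m ≤ t := Nat.sInf_le (by
      change T ≤ _
      omega)
    omega

theorem blockEnd_injective [Finite V] (hG : N.graph.Connected) (hc : ∃ r, cand r = true) (v : V) :
    Function.Injective (blockEnd k N cand v) := by
  intro m m' h
  have h1 := count_blockEnd (k := k) hG hc v m
  have h2 := count_blockEnd (k := k) hG hc v m'
  rw [h, h2] at h1
  have := Nat.eq_of_mul_eq_mul_right (by omega) h1
  omega

/-- What the state of a node says about its counter `c` and its block. -/
structure Tracks (N : Network V) (cand : V → Bool) (θ : V → ℕ → Fin (L + 1) × Bool) (c : ℕ)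
    (v : V) (s : ElectState k L) : Prop where
  joined : s.joined = true ↔ 0 < c
  lev : s.joined = true → s.lev = (N.level cand v : ZMod 3)
  cnt : s.cnt = (c : ZMod (3 * (2 * k + 2)))
  core : s.core = Core.logic cand θ (c / (2 * k + 2)) v
  info_le : ∀ o ∈ s.info, ∃ u, (Core.logic cand θ (c / (2 * k + 2)) u).Contributes o
  le_info : ∀ j ≤ c % (2 * k + 2), ∀ x, N.Reach cand x j v →
    ∀ o, (Core.logic cand θ (c / (2 * k + 2)) x).Contributes o → o ∈ s.info

theorem Tracks.alive_iff {θ : V → ℕ → Fin (L + 1) × Bool} {c : ℕ} {v : V} {s : ElectState k L}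
    (h : Tracks N cand θ c v s) (h0 : c = 0) : s.core.alive = true ↔ cand v = true := by
  rw [h.core, h0, Nat.zero_div, Core.logic]

/-- Neighbors differ by at most one in counter and level, so the residues decide all comparisons.
The flag `joined` separates counter 0 from its later multiples of the modulus, and stored levels
matter only for joined nodes. -/
theorem advances_iff (hG : N.graph.Connected) (hc : ∃ r, cand r = true)
    {θ : V → ℕ → Fin (L + 1) × Bool} {t : ℕ} {st : V → ElectState k L}
    (h : ∀ v, Tracks N cand θ (N.count cand t v) v (st v)) (v : V) :
    (st v).Advances (fun s => ∃ u, N.Nbr u v ∧ st u = s) ↔ N.Ready cand (N.count cand t) v := by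
  have hj := (h v).joined
  unfold Advances Network.Ready
  by_cases h0 : N.count cand t v = 0
  · rw [if_neg (by rw [hj]; omega), if_pos h0]
    have halive := (h v).alive_iff h0
    constructor
    · rintro (ha | ⟨_, ⟨u, hu, rfl⟩, hs⟩)
      · exact Or.inl (halive.1 ha)
      · exact Or.inr ⟨u, hu, (h u).joined.1 hs⟩
    · rintro (ha | ⟨u, hu, hs⟩)
      · exact Or.inl (halive.2 ha)
      · exact Or.inr ⟨_, ⟨u, hu, rfl⟩, (h u).joined.2 hs⟩
  · rw [if_pos (hj.2 (by omega)), if_neg h0]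
    have hu : ∀ u, N.Nbr u v → ((((st u).joined = true ∧ (st u).cnt + 1 ≠ (st v).cnt) ∧
        (Even (st v).cnt.val → (st u).lev + 1 = (st v).lev → (st u).cnt = (st v).cnt + 1) ∧
        (¬ Even (st v).cnt.val → (st u).lev = (st v).lev + 1 → (st u).cnt = (st v).cnt + 1)) ↔
        (N.count cand t v ≤ N.count cand t u ∧
        (Even (N.count cand t v) → N.level cand u + 1 = N.level cand v →
          N.count cand t v < N.count cand t u) ∧
        (¬ Even (N.count cand t v) → N.level cand u = N.level cand v + 1 →
          N.count cand t v < N.count cand t u))) := by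
      intro u hu
      have c1 := Network.count_le_of_nbr (cand := cand) t hu
      have c2 := Network.count_le_of_nbr (cand := cand) t hu.symm
      have l1 := Network.level_le_succ (cand := cand) hG hc hu
      have l2 := Network.level_le_succ (cand := cand) hG hc hu.symm
      have e1 : (st u).cnt + 1 = (st v).cnt ↔ N.count cand t u + 1 = N.count cand t v := by
        rw [(h u).cnt, (h v).cnt, ← Nat.cast_add_one, cast_eq_iff (by omega) (by omega)]
      have e2 : (st u).cnt = (st v).cnt + 1 ↔ N.count cand t u = N.count cand t v + 1 := by
        rw [(h u).cnt, (h v).cnt, ← Nat.cast_add_one, cast_eq_iff (by omega) (by omega)]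
      have e3 : Even (st v).cnt.val ↔ Even (N.count cand t v) := by
        rw [(h v).cnt, cast_val, cast_even]
      rw [ne_eq, e1, e2, e3]
      by_cases hju : (st u).joined = true
      · have e4 : (st u).lev + 1 = (st v).lev ↔ N.level cand u + 1 = N.level cand v := by
          rw [(h u).lev hju, (h v).lev (hj.2 (by omega)),
            RoundRule.natCast_add_one_eq_iff (by omega) (by omega)]
        have e5 : (st u).lev = (st v).lev + 1 ↔ N.level cand u = N.level cand v + 1 := by
          rw [(h u).lev hju, (h v).lev (hj.2 (by omega)), eq_comm,
            RoundRule.natCast_add_one_eq_iff (by omega) (by omega), eq_comm]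
        rw [e4, e5]
        have a1 : N.count cand t u = N.count cand t v + 1 ↔
          N.count cand t v < N.count cand t u := by omega
        have a2 : ((st u).joined = true ∧ ¬ N.count cand t u + 1 = N.count cand t v) ↔
          N.count cand t v ≤ N.count cand t u := by
          rw [and_iff_right hju]; omega
        rw [a1, a2]
      · have : ¬ 0 < N.count cand t u := fun hp => hju ((h u).joined.2 hp)
        constructor
        · rintro ⟨⟨hh, _⟩, _⟩; exact absurd hh hju
        · rintro ⟨hh, _⟩; omega
    constructor
    · intro hA u huv
      exact (hu u huv).1 (hA _ ⟨u, huv, rfl⟩)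
    · rintro hA _ ⟨u, huv, rfl⟩
      exact (hu u huv).2 (hA u huv)

/-- The waves follow counters that do not depend on the coins; `hR` makes the information complete
after `2k + 1` steps, and the last step of the block spends it on an update. -/
theorem tracks_run (hG : N.graph.Connected) (hc : ∃ r, cand r = true)
    (hR : ∀ x v, N.Reach cand x (2 * k + 1) v) (κ : V → ℕ → Fin (L + 1) × Bool) (t : ℕ) (v : V) :
    Tracks N cand (fun v m => κ v (blockEnd k N cand v m)) (N.count cand t v) v
      ((rule k L).run N cand κ t v) := by
  set θ : V → ℕ → Fin (L + 1) × Bool := fun v m => κ v (blockEnd k N cand v m) with hθ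
  induction t generalizing v with
  | zero =>
    refine ⟨by simp [RoundRule.run, rule, Network.count], by simp [RoundRule.run, rule],
      by simp [RoundRule.run, rule, Network.count], ?_, ?_, ?_⟩
    · simp only [Network.count, Nat.zero_div]
      rfl
    · simp only [Network.count, Nat.zero_div]
      intro o ho
      exact ⟨v, ho⟩
    · simp only [Network.count, Nat.zero_div, Nat.zero_mod]
      intro j hj x hx o ho
      obtain rfl : j = 0 := by omega
      cases hx
      exact ho
  | succ t ih =>
    set st := (rule k L).run N cand κ t with hst
    have hrun : (rule k L).run N cand κ (t + 1) v =
      (st v).next (fun s => ∃ u, N.Nbr u v ∧ st u = s) (κ v t) := rfl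
    rw [hrun]
    have hadv := advances_iff hG hc ih v
    by_cases hr : N.Ready cand (N.count cand t) v
    swap
    · rw [Network.count_succ_of_not_ready hr, next, if_neg (by rw [hadv]; exact hr)]
      exact ih v
    have hlev : (if (st v).joined = true then (st v).lev
        else (st v).joinLevel (fun s => ∃ u, N.Nbr u v ∧ st u = s)) = (N.level cand v : ZMod 3) := by
      split_ifs with hj
      · exact (ih v).lev hj
      · have h0 : ¬ 0 < N.count cand t v := fun hp => hj ((ih v).joined.2 hp)
        have halive := (ih v).alive_iff (by omega)
        rw [joinLevel]
        by_cases ha : (st v).core.alive = true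
        · rw [if_pos ha, (Network.level_eq_zero_iff hG hc).2 (halive.1 ha), Nat.cast_zero]
        have hex : ∃ σ, (∃ u, N.Nbr u v ∧ st u = σ) ∧ σ.joined = true := by
          have := hadv.2 hr
          rw [Advances, if_neg hj] at this
          exact this.resolve_left ha
        rw [if_neg ha, dif_pos hex]
        -- The arbitrary choice is harmless: a joined neighbor has level below `t`, while `v` has
        -- level at least `t`, so `u` is a parent of `v`.
        obtain ⟨⟨u, hu, hs⟩, hju⟩ := hex.choose_spec
        rw [← hs] at hju ⊢
        rw [(ih u).lev hju, ← Nat.cast_add_one]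
        have h1 := (ih u).joined.1 hju
        rw [Network.count_pos_iff hG hc] at h0 h1
        have := Network.level_le_succ (cand := cand) hG hc hu.symm
        congr 1
        omega
    have hcnt : (st v).cnt + 1 = ((N.count cand t v + 1 : ℕ) : ZMod (3 * (2 * k + 2))) := by
      rw [(ih v).cnt, Nat.cast_add_one]
    have hend : ((st v).cnt.val + 1) % (2 * k + 2) = (N.count cand t v + 1) % (2 * k + 2) := by
      rw [(ih v).cnt, cast_val, cast_mod]
    rw [Network.count_succ_of_ready hr, next, if_pos (hadv.2 hr), hend, hlev, hcnt]
    set c := N.count cand t v with hcdef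
    have hM : 0 < 2 * k + 2 := by omega
    split_ifs with hz
    · obtain ⟨m, hm⟩ : ∃ m, c + 1 = (m + 1) * (2 * k + 2) := by
        obtain ⟨q, hq⟩ := Nat.dvd_of_mod_eq_zero hz
        rcases q with _ | q
        · omega
        · exact ⟨q, by rw [hq]; ring⟩
      have hc1 : (c + 1) / (2 * k + 2) = m + 1 := by rw [hm, Nat.mul_div_cancel _ hM]
      have hc2 : c = m * (2 * k + 2) + (2 * k + 1) := by
        have : (m + 1) * (2 * k + 2) = m * (2 * k + 2) + (2 * k + 2) := by ring
        omega
      have hc0 : c / (2 * k + 2) = m := by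
        rw [hc2, Nat.mul_comm, Nat.mul_add_div hM, Nat.div_eq_of_lt (by omega), add_zero]
      have hcm : c % (2 * k + 2) = 2 * k + 1 := by
        rw [hc2, Nat.mul_comm, Nat.mul_add_mod, Nat.mod_eq_of_lt (by omega)]
      have hbe : blockEnd k N cand v m = t := by
        apply blockEnd_eq
        · rw [← hcdef, ← hm]; omega
        · rw [Network.count_succ_of_ready hr, ← hcdef, hm]
      have hinfo : (st v).info = {o | ∃ u, (Core.logic cand θ m u).Contributes o} := by
        apply Set.Subset.antisymm
        · intro o ho
          have := (ih v).info_le o ho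
          rwa [← hcdef, hc0] at this
        · rintro o ⟨u, hu⟩
          refine (ih v).le_info (2 * k + 1) (by rw [← hcdef, hcm]) u (hR u v) o ?_
          rwa [← hcdef, hc0]
      have hcore : (st v).core.update (st v).info (κ v t) = Core.logic cand θ (m + 1) v := by
        rw [hinfo, (ih v).core, ← hcdef, hc0, Core.logic, hθ]
        simp only [hbe]
      rw [hcore]
      refine ⟨by simp, fun _ => rfl, rfl, by rw [hc1], ?_, ?_⟩
      · rw [hc1]
        intro o ho
        exact ⟨v, ho⟩
      · rw [hc1, hz]
        intro j hj x hx o ho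
        obtain rfl : j = 0 := by omega
        cases hx
        exact ho
    · have hdiv : (c + 1) / (2 * k + 2) = c / (2 * k + 2) := by
        rw [Nat.succ_div, if_neg (fun h => hz (Nat.mod_eq_zero_of_dvd h)), add_zero]
      have hmod : (c + 1) % (2 * k + 2) = c % (2 * k + 2) + 1 := by
        have h1 := Nat.div_add_mod c (2 * k + 2)
        have h2 := Nat.div_add_mod (c + 1) (2 * k + 2)
        rw [hdiv] at h2
        omega
      -- Away from block ends, the neighbors of a node that advances are in its own block, so no
      -- information from different blocks is mixed.
      have hnb : ∀ u, N.Nbr u v → N.count cand t u / (2 * k + 2) = c / (2 * k + 2) ∧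
          (N.count cand t u = c ∨ N.count cand t u = c + 1) := by
        intro u hu
        have h1 := Network.le_of_ready hr hu
        have h2 := Network.count_le_of_nbr (cand := cand) t hu.symm
        rcases (by omega : N.count cand t u = c ∨ N.count cand t u = c + 1) with h | h
        · rw [h]; exact ⟨rfl, Or.inl rfl⟩
        · rw [h]; exact ⟨hdiv, Or.inr rfl⟩
      refine ⟨by simp, fun _ => rfl, rfl, ?_, ?_, ?_⟩
      · rw [hdiv]; exact (ih v).core
      · rw [hdiv]
        rintro o (ho | ⟨_, ⟨u, hu, rfl⟩, ho⟩)
        · exact (ih v).info_le o ho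
        · rw [← (hnb u hu).1]; exact (ih u).info_le o ho
      · rw [hdiv, hmod]
        intro j hj x hx o ho
        have hv := (ih v).le_info
        have hnbr : ∀ u, N.Nbr u v → ∀ j ≤ N.count cand t u % (2 * k + 2), N.Reach cand x j u →
            o ∈ (st v).info ∪ {o | ∃ σ, (∃ u, N.Nbr u v ∧ st u = σ) ∧ o ∈ σ.info} := by
          intro u hu j hj hx
          refine Or.inr ⟨st u, ⟨u, hu, rfl⟩, (ih u).le_info j hj x hx o ?_⟩
          rw [(hnb u hu).1]; exact ho
        have hge : ∀ u, N.Nbr u v → c % (2 * k + 2) ≤ N.count cand t u % (2 * k + 2) := by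
          intro u hu
          rcases (hnb u hu).2 with h | h <;> rw [h]
          rw [hmod]; omega
        have hev : Even c ↔ Even (c % (2 * k + 2)) := by
          rw [Nat.even_iff, Nat.even_iff, Nat.mod_mod_of_dvd]
          exact ⟨k + 1, by ring⟩
        rcases Nat.lt_or_ge j (c % (2 * k + 2) + 1) with hlt | hge'
        · exact Or.inl (hv j (by rw [← hcdef]; omega) x hx o ho)
        · obtain rfl : j = c % (2 * k + 2) + 1 := by omega
          cases hx with
          | stay h => exact Or.inl (hv _ le_rfl x h o ho)
          | nbr h hu => exact hnbr _ hu _ (hge _ hu) h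
          | down he h hu hl =>
            have := Network.lt_of_ready_of_even hG hc hr (hev.2 he) hu hl
            rcases (hnb _ hu).2 with h' | h'
            · omega
            · exact hnbr _ hu _ (by rw [h', hmod]) h
          | up he h hu hl =>
            have := Network.lt_of_ready_of_odd hr (fun h => he (hev.1 h)) hu hl
            rcases (hnb _ hu).2 with h' | h'
            · omega
            · exact hnbr _ hu _ (by rw [h', hmod]) h

end ElectState

/-! ### The election as a process on blocks -/

namespace Core

variable {L : ℕ} {V : Type} {cand : V → Bool} {θ : V → ℕ → Fin (L + 1) × Bool}

theorem timer_logic (m : ℕ) (v : V) :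
    (logic cand θ m v).timer = true ↔ ∀ i < m, (θ v i).2 = true := by
  induction m with
  | zero => simp [logic]
  | succ m ih =>
    simp only [logic, update, Bool.and_eq_true, ih]
    constructor
    · rintro ⟨h1, h2⟩ i hi
      rcases Nat.lt_succ_iff_lt_or_eq.1 hi with h | rfl
      · exact h1 i h
      · exact h2
    · intro h
      exact ⟨fun i hi => h i (by omega), h m (Nat.lt_succ_self m)⟩

theorem alive_logic_succ (m : ℕ) (v : V) :
    (logic cand θ (m + 1) v).alive = true ↔ (logic cand θ m v).alive = true ∧
      ∀ u, (logic cand θ m u).alive = true →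
        (logic cand θ m u).color ≤ (logic cand θ m v).color := by
  simp only [logic, update, Bool.and_eq_true, decide_eq_true_eq, Set.mem_ofPred_eq]
  refine and_congr_right fun _ => ⟨fun h u hu => h _ ⟨u, hu, rfl⟩, ?_⟩
  rintro h x ⟨u, hu, rfl⟩
  exact h u hu

/-- A survivor of maximal color always survives. -/
theorem exists_alive [Finite V] (hc : ∃ r, cand r = true) (m : ℕ) :
    ∃ v, (logic cand θ m v).alive = true := by
  induction m with
  | zero => exact hc
  | succ m ih =>
    obtain ⟨v, hv, hmax⟩ := Set.exists_max_image {v | (logic cand θ m v).alive = true}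
      (fun v => (logic cand θ m v).color) (Set.toFinite _) ih
    exact ⟨v, (alive_logic_succ m v).2 ⟨hv, hmax⟩⟩

theorem alive_antitone {m m' : ℕ} (h : m ≤ m') {v : V} (hv : (logic cand θ m' v).alive = true) :
    (logic cand θ m v).alive = true := by
  induction m', h using Nat.le_induction with
  | base => exact hv
  | succ m' _ ih => exact ih ((alive_logic_succ m' v).1 hv).1

/-- Two survivors both have the maximal color. Coin `i` is the color of block `i + 1`, and block 0
uses the constant color 0, so `m + 1` blocks compare `m` coins. -/
theorem coin_eq_of_alive {m i : ℕ} (hi : i < m) {u v : V}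
    (hu : (logic cand θ (m + 1) u).alive = true) (hv : (logic cand θ (m + 1) v).alive = true) :
    (θ u i).1 = (θ v i).1 := by
  have hu' := (alive_logic_succ (i + 1) u).1 (alive_antitone (by omega) hu)
  have hv' := (alive_logic_succ (i + 1) v).1 (alive_antitone (by omega) hv)
  exact le_antisymm (hv'.2 u hu'.1) (hu'.2 v hv'.1)

theorem decision_mono {m m' : ℕ} (h : m ≤ m') {v : V} {d : Bool}
    (hd : (logic cand θ m v).decision = some d) : (logic cand θ m' v).decision = some d := by
  induction m', h using Nat.le_induction with
  | base => exact hd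
  | succ m' _ ih => simp only [logic, update, ih]

theorem decision_eq_none {m : ℕ} (h : ∀ i < m, ∃ v, (logic cand θ i v).timer = true) (v : V) :
    (logic cand θ m v).decision = none := by
  induction m with
  | zero => rfl
  | succ m ih =>
    simp only [logic, update, ih fun i hi => h i (by omega)]
    rw [if_pos]
    exact h m (Nat.lt_succ_self m)

theorem decision_of_no_timer {m : ℕ} (h : ∀ i < m, ∃ v, (logic cand θ i v).timer = true)
    (hm : ¬ ∃ v, (logic cand θ m v).timer = true) (v : V) :
    (logic cand θ (m + 1) v).decision = some (logic cand θ (m + 1) v).alive := by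
  simp only [logic, update, decision_eq_none h]
  rw [if_neg]
  exact hm

/-- If all timers stop within `m₀` blocks, then all nodes decide at the end of the same block. -/
theorem exists_common_decision {m₀ : ℕ} (h : ∀ v, ∃ i < m₀, (θ v i).2 = false) :
    ∃ T ≤ m₀, (∀ v, ∃ i < T, (θ v i).2 = false) ∧
      ∀ v, (logic cand θ (T + 1) v).decision = some (logic cand θ (T + 1) v).alive := by
  classical
  have key : ∀ m, (¬ ∃ v, (logic cand θ m v).timer = true) ↔ ∀ v, ∃ i < m, (θ v i).2 = false := by
    intro m
    simp [timer_logic]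
  have hex : ∃ m, ¬ ∃ v, (logic cand θ m v).timer = true := ⟨m₀, (key m₀).2 h⟩
  refine ⟨Nat.find hex, Nat.find_min' hex ((key m₀).2 h), (key _).1 (Nat.find_spec hex), ?_⟩
  exact decision_of_no_timer (fun i hi => not_not.1 (Nat.find_min hex hi)) (Nat.find_spec hex)

/-- If all timers stop within `m₀` blocks and no two candidates agree in all their colors up to a
block by which all timers have stopped, then exactly one candidate survives. -/
theorem exists_leader [Finite V] (hc : ∃ r, cand r = true) {m₀ : ℕ}
    (h : ∀ v, ∃ i < m₀, (θ v i).2 = false)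
    (htie : ∀ m, 1 ≤ m → m ≤ m₀ → ∀ u v, cand u = true → cand v = true → u ≠ v →
      (∀ w, ∃ i < m, (θ w i).2 = false) → ¬ ∀ i < m, (θ u i).1 = (θ v i).1) :
    SelectsLeader cand fun v => (logic cand θ (m₀ + 1) v).decision := by
  obtain ⟨T, hT, halt, hdec⟩ := exists_common_decision (cand := cand) h
  obtain ⟨l, hl⟩ := exists_alive (θ := θ) hc (T + 1)
  refine ⟨l, alive_antitone (Nat.zero_le _) hl,
    decision_mono (Nat.succ_le_succ hT) ((hdec l).trans (by rw [hl])), fun v hv => ?_⟩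
  refine decision_mono (Nat.succ_le_succ hT) ((hdec v).trans ?_)
  by_contra hne
  have hv' : (logic cand θ (T + 1) v).alive = true := by simpa using hne
  have hT1 : 1 ≤ T := by
    obtain ⟨i, hi, _⟩ := halt l
    omega
  exact htie T hT1 hT v l (alive_antitone (Nat.zero_le _) hv') (alive_antitone (Nat.zero_le _) hl)
    hv halt fun i hi => coin_eq_of_alive hi hv' hl

end Core

/-! ### Transfer of decisions to the asynchronous execution -/

namespace ElectState

variable {k L : ℕ} {V : Type} [Fintype V] {N : Network V} {cand : V → Bool}

theorem out_run_of_decision (hG : N.graph.Connected) (hc : ∃ r, cand r = true)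
    (hk : (Finset.univ.filter fun v => cand v = true).card ≤ k) (κ : V → ℕ → Fin (L + 1) × Bool)
    {m t : ℕ} (ht : m * (2 * k + 2) * (N.graph.diam + 1) ≤ t) {v : V} {d : Bool}
    (hd : (Core.logic cand (fun v m => κ v (blockEnd k N cand v m)) m v).decision = some d) :
    (rule k L).out ((rule k L).run N cand κ t v) = some d := by
  have h := (tracks_run hG hc (Network.reach_all hG hc hk) κ t v).core
  change ((rule k L).run N cand κ t v).core.decision = some d
  rw [h]
  refine Core.decision_mono ?_ hd
  rw [Nat.le_div_iff_mul_le (by omega)]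
  exact (Network.le_count hG hc (Network.level_le_diam hG hc) _ v).trans
    (Network.count_mono v ht)

/-- The coin that `v` tosses at the end of block `m`. -/
noncomputable def blockCoin (k L : ℕ) (cand : V → Bool) (S : Schedule N)
    (ω : (rule k L).toSA.Choices V) (v : V) (m : ℕ) : Fin (L + 1) × Bool :=
  (rule k L).coinRule.coin
    ((rule k L).toSA.outcome cand S ω v (S.advance v (blockEnd k N cand v m)))

/-- A pulse of at least `p + 1` means that `p` rounds are complete, and `D + 1` rounds per counter
step suffice for `m` blocks. -/
theorem outputAt_of_decision (hG : N.graph.Connected) (hc : ∃ r, cand r = true)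
    (hk : (Finset.univ.filter fun v => cand v = true).card ≤ k) {S : Schedule N}
    {ω : (rule k L).toSA.Choices V} (hω : ∀ x, ω x ∈ (rule k L).toSA.τ x.2.2.1 x.2.2.2)
    {m j : ℕ} {v : V} {d : Bool} {t : ℝ}
    (hd : (Core.logic cand (blockCoin k L cand S ω) m v).decision = some d)
    (hj : S.act v j ≤ t) (hp : m * (2 * k + 2) * (N.graph.diam + 1) + 1 ≤ S.pulse v j) :
    (rule k L).toSA.outputAt cand S ω t v = some d := by
  set ρ := fun v i => (rule k L).coinRule.coin ((rule k L).toSA.outcome cand S ω v i) with hρ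
  have h1 := (rule k L).coinRule.outcome_eq_drive_coin (inp := cand) (S := S) hω
  have h2 : (rule k L).toSA.stateAfter cand S ω =
      (rule k L).toSA.stateAfter cand S ((rule k L).coinRule.drive ρ) := by
    funext v i
    cases i with
    | zero => rfl
    | succ i =>
      simp only [SAAlgorithm.stateAfter]
      exact congrArg Prod.fst (congrFun (congrFun h1 v) i)
  unfold SAAlgorithm.outputAt
  rw [h2, RoundRule.output_toSA]
  refine out_run_of_decision hG hc hk _ (m := m) ?_ hd
  have := S.pulse_le_pulseBefore (v := v) (S.lt_numAct hj)
  omega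

end ElectState

instance {I O V : Type} (A : SAAlgorithm I O) : IsProbabilityMeasure (A.choiceMeasure V) := by
  unfold SAAlgorithm.choiceMeasure
  infer_instance

/-! ### Probability bounds -/

namespace ElectState

variable {k L : ℕ} {V : Type} [Fintype V] {N : Network V} {cand : V → Bool}

/-- Both `advance` and `blockEnd` are independent of the random choices and injective, so block
coins are coins of distinct, predetermined activations. -/
theorem measure_blockCoin_mem_le (hG : N.graph.Connected) (hc : ∃ r, cand r = true)
    (S : Schedule N) {J : Type} [Fintype J] (ι : J → V × ℕ) (hι : Function.Injective ι)
    (E : Finset (J → Fin (L + 1) × Bool)) {a : ℕ} (hE : E.card ≤ a) :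
    ((rule k L).toSA.choiceMeasure V).real
      {ω | (fun j => blockCoin k L cand S ω (ι j).1 (ι j).2) ∈ E} ≤
      a / (((L : ℝ) + 1) * 2) ^ Fintype.card J := by
  have h := (rule k L).coinRule.measure_coin_mem_le cand S
    (fun j => ((ι j).1, S.advance (ι j).1 (blockEnd k N cand (ι j).1 (ι j).2)))
    (fun x y hxy => hι (by
      rw [Prod.mk.injEq] at hxy
      obtain ⟨h1, h2⟩ := hxy
      rw [h1] at h2
      exact Prod.ext h1 (blockEnd_injective hG hc _ (S.advance_injective _ h2)))) E
  have h' := ENNReal.toReal_mono (by finiteness) h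
  refine h'.trans ?_
  rw [ENNReal.toReal_mul, ENNReal.toReal_pow, ENNReal.toReal_inv, ENNReal.toReal_natCast,
    ENNReal.toReal_natCast, inv_pow, ← div_eq_mul_inv, Fintype.card_prod, Fintype.card_fin,
    Fintype.card_bool]
  push_cast
  gcongr

/-- The probability that some timer runs for `m` blocks. -/
theorem measure_late_le (hG : N.graph.Connected) (hc : ∃ r, cand r = true) (S : Schedule N)
    (m : ℕ) :
    ((rule k L).toSA.choiceMeasure V).real
      {ω | ¬ ∀ v, ∃ i < m, (blockCoin k L cand S ω v i).2 = false} ≤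
      Fintype.card V * (1 / 2) ^ m := by
  classical
  let E : Finset (Fin m → Fin (L + 1) × Bool) :=
    Fintype.piFinset fun _ => Finset.univ ×ˢ {true}
  have hE : E.card ≤ (L + 1) ^ m := by
    simp [E, Fintype.card_piFinset]
  have h1 : ∀ v, ((rule k L).toSA.choiceMeasure V).real
      {ω | (fun j : Fin m => blockCoin k L cand S ω v j) ∈ E} ≤ (1 / 2) ^ m := by
    intro v
    refine (measure_blockCoin_mem_le hG hc S (fun j : Fin m => (v, (j : ℕ)))
      (fun x y h => Fin.ext (Prod.mk.inj h).2) E hE).trans (le_of_eq ?_)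
    push_cast
    rw [Fintype.card_fin, mul_pow, div_pow, one_pow]
    field_simp
  calc _ ≤ ((rule k L).toSA.choiceMeasure V).real
        (⋃ v, {ω | (fun j : Fin m => blockCoin k L cand S ω v j) ∈ E}) := by
        refine measureReal_mono ?_
        intro ω hω
        simp only [Set.mem_ofPred_eq, not_forall, not_exists, not_and, Bool.not_eq_false] at hω
        obtain ⟨v, hv⟩ := hω
        refine Set.mem_iUnion.2 ⟨v, ?_⟩
        simp only [E, Set.mem_ofPred_eq, Fintype.mem_piFinset, Finset.mem_product,
          Finset.mem_univ, true_and, Finset.mem_singleton]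
        exact fun j => hv j j.2
    _ ≤ ∑ v, _ := measureReal_iUnion_fintype_le _
    _ ≤ ∑ _v : V, (1 / 2 : ℝ) ^ m := Finset.sum_le_sum fun v _ => h1 v
    _ = _ := by simp

/-- The probability that all timers stop within `m` blocks in which `u` and `v` draw the same
colors. -/
theorem measure_tie_le (hG : N.graph.Connected) (hc : ∃ r, cand r = true) (S : Schedule N)
    (m : ℕ) {u v : V} (huv : u ≠ v) :
    ((rule k L).toSA.choiceMeasure V).real
      {ω | (∀ w, ∃ i < m, (blockCoin k L cand S ω w i).2 = false) ∧
        ∀ i < m, (blockCoin k L cand S ω u i).1 = (blockCoin k L cand S ω v i).1} ≤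
      (1 - (1 / 2) ^ m) ^ Fintype.card V / ((L : ℝ) + 1) ^ m := by
  classical
  let E : Finset (V × Fin m → Fin (L + 1) × Bool) := Finset.univ.filter fun f =>
    (∀ w, ∃ i, (f (w, i)).2 = false) ∧ ∀ i, (f (u, i)).1 = (f (v, i)).1
  -- A tie determines the colors of `u` from those of `v`, which saves a factor `(L + 1) ^ m`; the
  -- timer bits of each node avoid the all-`true` word.
  let F : Finset ((V → Fin m → Bool) × ({w // w ≠ u} → Fin m → Fin (L + 1))) :=
    (Fintype.piFinset fun _ => Finset.univ.erase fun _ => true) ×ˢ Finset.univ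
  have hF : F.card = (2 ^ m - 1) ^ Fintype.card V * ((L + 1) ^ m) ^ (Fintype.card V - 1) := by
    simp [F, Fintype.card_piFinset, Finset.card_erase_of_mem, Fintype.card_subtype_compl]
  have hE : E.card ≤ (2 ^ m - 1) ^ Fintype.card V * ((L + 1) ^ m) ^ (Fintype.card V - 1) := by
    rw [← hF]
    refine Finset.card_le_card_of_injOn
      (fun f => (fun w i => (f (w, i)).2, fun w i => (f (w.1, i)).1)) ?_ ?_
    · intro f hf
      simp only [E, Finset.coe_filter, Finset.mem_univ, true_and, Set.mem_ofPred_eq] at hf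
      simp only [F, Finset.mem_coe, Finset.mem_product, Fintype.mem_piFinset, Finset.mem_erase,
        Finset.mem_univ, and_true]
      intro w hw
      obtain ⟨i, hi⟩ := hf.1 w
      have := congrFun hw i
      change (f (w, i)).2 = true at this
      rw [hi] at this
      exact absurd this (by simp)
    · intro f hf g hg hfg
      simp only [E, Finset.coe_filter, Finset.mem_univ, true_and, Set.mem_ofPred_eq] at hf hg
      simp only [Prod.mk.injEq] at hfg
      have h2 : ∀ w i, (f (w, i)).2 = (g (w, i)).2 := fun w i => congrFun (congrFun hfg.1 w) i
      have h1 : ∀ w, w ≠ u → ∀ i, (f (w, i)).1 = (g (w, i)).1 :=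
        fun w hw i => congrFun (congrFun hfg.2 ⟨w, hw⟩) i
      funext ⟨w, i⟩
      refine Prod.ext ?_ (h2 w i)
      by_cases hw : w = u
      · rw [hw, hf.2, hg.2, h1 v huv.symm]
      · exact h1 w hw i
  have hι : Function.Injective fun j : V × Fin m => (j.1, (j.2 : ℕ)) := by
    rintro ⟨a, i⟩ ⟨b, j⟩ h
    simp only [Prod.mk.injEq] at h
    exact Prod.ext h.1 (Fin.ext h.2)
  have key := measure_blockCoin_mem_le (k := k) hG hc S _ hι E hE
  refine le_trans (measureReal_mono ?_) (key.trans (le_of_eq ?_))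
  · rintro ω ⟨h1, h2⟩
    simp only [E, Set.mem_ofPred_eq, Finset.mem_filter, Finset.mem_univ, true_and]
    refine ⟨fun w => ?_, fun i => h2 i i.2⟩
    obtain ⟨i, hi, h⟩ := h1 w
    exact ⟨⟨i, hi⟩, h⟩
  · have hn : 0 < Fintype.card V := Fintype.card_pos_iff.2 ⟨u⟩
    obtain ⟨n, hn'⟩ : ∃ n, Fintype.card V = n + 1 := ⟨Fintype.card V - 1, by omega⟩
    rw [Fintype.card_prod, Fintype.card_fin, hn', Nat.add_sub_cancel]
    push_cast [Nat.one_le_two_pow]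
    have hL : (0 : ℝ) < (L : ℝ) + 1 := by positivity
    have h1 : (1 - (1 / 2 : ℝ) ^ m) = (2 ^ m - 1) / 2 ^ m := by
      rw [div_pow, one_pow]; field_simp
    rw [h1, div_pow, mul_pow, ← pow_mul 2 m (n + 1), mul_comm m (n + 1), ← pow_mul,
      mul_comm m n, add_mul, one_mul, pow_add ((L : ℝ) + 1)]
    field_simp

/-- From `1 - x ≤ exp (-x)` and `exp y ≥ y ^ j / j!`. A polynomial bound suffices, and it combines
with the geometric factor coming from the colors. -/
theorem one_sub_pow_le {x : ℝ} (hx : 0 < x) (hx1 : x ≤ 1) {n : ℕ} (hn : 0 < n) (j : ℕ) :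
    (1 - x) ^ n ≤ j.factorial / (n * x) ^ j := by
  have hn' : (0 : ℝ) < n := by exact_mod_cast hn
  have h1 : (1 - x) ^ n ≤ Real.exp (-(n * x)) := by
    calc (1 - x) ^ n ≤ Real.exp (-x) ^ n :=
          pow_le_pow_left₀ (by linarith) (Real.one_sub_le_exp_neg x) n
      _ = Real.exp (-(n * x)) := by rw [← Real.exp_nat_mul]; ring_nf
  have h2 := Real.pow_div_factorial_le_exp (n * x) (by positivity) j
  have hf : (0 : ℝ) < j.factorial := by exact_mod_cast j.factorial_pos
  refine h1.trans ?_
  rw [Real.exp_neg, ← one_div, div_le_div_iff₀ (Real.exp_pos _) (by positivity)]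
  rw [div_le_iff₀ hf] at h2
  linarith

/-- The bad events have small probability if there are enough colors. -/
theorem measure_bad_le (hG : N.graph.Connected) (hc : ∃ r, cand r = true) (S : Schedule N)
    (hk : (Finset.univ.filter fun v => cand v = true).card ≤ k) (hk0 : 0 < k)
    {j : ℕ} (hL : L + 1 = 2 ^ j * (4 * k ^ 2 * j.factorial)) (m₀ : ℕ) :
    ((rule k L).toSA.choiceMeasure V).real
      {ω | ¬ ∀ m, 1 ≤ m → m ≤ m₀ → ∀ u v, cand u = true → cand v = true → u ≠ v →
        (∀ w, ∃ i < m, (blockCoin k L cand S ω w i).2 = false) →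
        ¬ ∀ i < m, (blockCoin k L cand S ω u i).1 = (blockCoin k L cand S ω v i).1} ≤
      1 / (2 * (Fintype.card V : ℝ) ^ j) := by
  classical
  set μ := (rule k L).toSA.choiceMeasure V
  have hprob : IsProbabilityMeasure μ := inferInstanceAs
    (IsProbabilityMeasure ((rule k L).toSA.choiceMeasure V))
  set C := Finset.univ.filter fun v => cand v = true with hC
  have hn : 0 < Fintype.card V := by
    obtain ⟨r, _⟩ := hc
    exact Fintype.card_pos_iff.2 ⟨r⟩
  have hn' : (0 : ℝ) < Fintype.card V := by exact_mod_cast hn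
  let bad : ℕ → V × V → Set ((rule k L).toSA.Choices V) := fun i p =>
    {ω | (∀ w, ∃ i' < i + 1, (blockCoin k L cand S ω w i').2 = false) ∧
      ∀ i' < i + 1, (blockCoin k L cand S ω p.1 i').1 = (blockCoin k L cand S ω p.2 i').1}
  have hsub : {ω | ¬ ∀ m, 1 ≤ m → m ≤ m₀ → ∀ u v, cand u = true → cand v = true → u ≠ v →
        (∀ w, ∃ i < m, (blockCoin k L cand S ω w i).2 = false) →
        ¬ ∀ i < m, (blockCoin k L cand S ω u i).1 = (blockCoin k L cand S ω v i).1} ⊆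
      ⋃ i ∈ Finset.range m₀, ⋃ p ∈ C.offDiag, bad i p := by
    intro ω hω
    simp only [Set.mem_ofPred_eq] at hω
    push Not at hω
    obtain ⟨m, h1, hm, u, v, hu, hv, huv, hA, hB⟩ := hω
    obtain ⟨i, rfl⟩ : ∃ i, m = i + 1 := ⟨m - 1, by omega⟩
    simp only [Set.mem_iUnion]
    refine ⟨i, by simpa using hm, (u, v), ?_, hA, hB⟩
    simp [hC, hu, hv, huv]
  -- In the palette size `2 ^ j * K`, the factor `2 ^ j` cancels the growth of the timer bound per
  -- block. In `K`, `k ^ 2` pays for the pairs of candidates, `j!` for the exponential bound, and 4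
  -- for the geometric series and the final 1/2.
  set K : ℝ := 4 * k ^ 2 * j.factorial with hK
  have hf : (1 : ℝ) ≤ j.factorial := by exact_mod_cast j.factorial_pos
  have hk1 : (1 : ℝ) ≤ k := by exact_mod_cast hk0
  have hk2 : (1 : ℝ) ≤ k ^ 2 := one_le_pow₀ hk1
  have hK2 : 2 ≤ K := by
    rw [hK]
    nlinarith [mul_le_mul hk2 hf zero_le_one (by positivity)]
  have hLK : (L : ℝ) + 1 = 2 ^ j * K := by
    rw [hK]; exact_mod_cast hL
  have hbad : ∀ i, ∀ p ∈ C.offDiag, μ.real (bad i p) ≤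
      j.factorial / (Fintype.card V : ℝ) ^ j * (1 / K * (1 / 2) ^ i) := by
    rintro i ⟨u, v⟩ hp
    have huv : u ≠ v := (Finset.mem_offDiag.1 hp).2.2
    refine (measure_tie_le hG hc S (i + 1) huv).trans ?_
    have hx : (0 : ℝ) < (1 / 2) ^ (i + 1) := by positivity
    have h1 := one_sub_pow_le hx (pow_le_one₀ (by norm_num) (by norm_num)) hn j
    calc _ ≤ (j.factorial / (Fintype.card V * (1 / 2 : ℝ) ^ (i + 1)) ^ j) /
            ((L : ℝ) + 1) ^ (i + 1) := by
          gcongr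
      _ = j.factorial / (Fintype.card V : ℝ) ^ j * (1 / K) ^ (i + 1) := by
          rw [hLK, mul_pow, mul_pow, div_pow, div_pow, div_pow, one_pow, one_pow,
            ← pow_mul 2 j, ← pow_mul, mul_comm j]
          field_simp
      _ ≤ _ := by
          rw [pow_succ' (1 / K)]
          gcongr
  have hcard : ((C.offDiag).card : ℝ) ≤ k ^ 2 := by
    have h1 : (C.offDiag).card ≤ C.card * C.card := by
      rw [Finset.offDiag_card]; exact Nat.sub_le _ _
    have h2 : C.card * C.card ≤ k ^ 2 := by
      rw [sq]; exact Nat.mul_le_mul hk hk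
    exact_mod_cast h1.trans h2
  calc _ ≤ μ.real (⋃ i ∈ Finset.range m₀, ⋃ p ∈ C.offDiag, bad i p) :=
        measureReal_mono hsub (measure_ne_top _ _)
    _ ≤ ∑ i ∈ Finset.range m₀, ∑ p ∈ C.offDiag, μ.real (bad i p) :=
        (measureReal_biUnion_finset_le _ _).trans
          (Finset.sum_le_sum fun i _ => measureReal_biUnion_finset_le _ _)
    _ ≤ ∑ i ∈ Finset.range m₀, ∑ p ∈ C.offDiag,
          j.factorial / (Fintype.card V : ℝ) ^ j * (1 / K * (1 / 2) ^ i) :=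
        Finset.sum_le_sum fun i _ => Finset.sum_le_sum (hbad i)
    _ = (C.offDiag).card * (j.factorial / (Fintype.card V : ℝ) ^ j * (1 / K)) *
          ∑ i ∈ Finset.range m₀, (1 / 2 : ℝ) ^ i := by
        simp only [Finset.sum_const, nsmul_eq_mul]
        rw [Finset.mul_sum]
        exact Finset.sum_congr rfl fun i _ => by ring
    _ ≤ k ^ 2 * (j.factorial / (Fintype.card V : ℝ) ^ j * (1 / K)) * 2 := by
        gcongr
        exact sum_geometric_two_le m₀
    _ = _ := by
        rw [hK]
        field_simp
        norm_num

end ElectState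

/-! ### Choice of constants and proof of the theorem -/

open ElectState in
theorem theorem1 :
    ∃ a : ℕ, ∀ (k : ℕ) (c : ℝ), 0 < c →
      ∃ A : SAAlgorithm Bool Bool, A.Irrevocable ∧
        ∃ C : ℝ, ∀ (V : Type) [Fintype V] (N : Network V), N.graph.Connected →
          ∀ cand : V → Bool,
            1 ≤ (Finset.univ.filter fun v => cand v = true).card →
            (Finset.univ.filter fun v => cand v = true).card ≤ k →
            ∀ S : Schedule N,
              (∀ᵐ ω ∂(A.choiceMeasure V), ∃ t : ℝ, ∀ v, A.outputAt cand S ω t v ≠ none) ∧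
              1 - (Fintype.card V : ℝ) ^ (-c) ≤
                (A.choiceMeasure V).real
                  {ω | (∃ t : ℝ, SelectsLeader cand (A.outputAt cand S ω t)) ∧
                    ∀ b : ℝ, S.BoundedBy b →
                      SelectsLeader cand (A.outputAt cand S ω
                        (C * N.graph.diam * Real.log (Fintype.card V) ^ a * b))} := by
  refine ⟨1, fun k c hc0 => ?_⟩
  rcases Nat.eq_zero_or_pos k with rfl | hk0
  · refine ⟨(rule 0 0).toSA, RoundRule.irrevocable_toSA _, 0, ?_⟩
    intro V _ N _ cand h1 h2
    omega
  set j := ⌈c⌉₊ with hj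
  obtain ⟨L, hL⟩ : ∃ L, L + 1 = 2 ^ j * (4 * k ^ 2 * j.factorial) := by
    have : 0 < 2 ^ j * (4 * k ^ 2 * j.factorial) := by
      have := j.factorial_pos
      positivity
    exact ⟨_, Nat.succ_pred_eq_of_pos this⟩
  refine ⟨(rule k L).toSA, RoundRule.irrevocable_toSA _,
    6 * (2 * k + 2) * ((c + 4) / Real.log 2), ?_⟩
  intro V _ N hG cand hcard hk S
  have hc : ∃ r, cand r = true := by
    obtain ⟨r, hr⟩ := Finset.card_pos.1 hcard
    exact ⟨r, by simpa using hr⟩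
  set A := (rule k L).toSA
  set μ := A.choiceMeasure V with hμ
  set n := Fintype.card V with hn
  -- the time by which all nodes have reached the end of block `m`
  have htime : ∀ m : ℕ, ∃ t : ℝ, ∀ v, ∃ i, S.act v i ≤ t ∧
      m * (2 * k + 2) * (N.graph.diam + 1) + 1 ≤ S.pulse v i := by
    intro m
    choose i hi using S.exists_pulse_ge (m * (2 * k + 2) * (N.graph.diam + 1) + 1)
    obtain ⟨t, ht⟩ := (Set.finite_range fun v => S.act v (i v)).bddAbove
    exact ⟨t, fun v => ⟨i v, ht ⟨v, rfl⟩, hi v⟩⟩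
  constructor
  · have hlate : ∀ᵐ ω ∂μ, ∃ m, ∀ v, ∃ i < m, (blockCoin k L cand S ω v i).2 = false := by
      rw [ae_iff]
      -- Never stopping is contained in each event of running for `m` blocks, of probability at most
      -- `n * (1 / 2) ^ m`, which tends to 0.
      have hzero : μ.real {ω | ¬ ∃ m, ∀ v, ∃ i < m, (blockCoin k L cand S ω v i).2 = false} ≤ 0 := by
        refine ge_of_tendsto' (x := atTop) (f := fun m : ℕ => (n : ℝ) * (1 / 2) ^ m) ?_ fun m => ?_
        · simpa using (tendsto_pow_atTop_nhds_zero_of_lt_one (r := (1 / 2 : ℝ)) (by norm_num)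
            (by norm_num)).const_mul (n : ℝ)
        · refine le_trans (measureReal_mono ?_) (measure_late_le hG hc S m)
          intro ω hω hall
          exact hω ⟨m, hall⟩
      have := le_antisymm hzero measureReal_nonneg
      rwa [measureReal_eq_zero_iff] at this
    filter_upwards [hlate, A.ae_mem_τ V] with ω ⟨m, hm⟩ hω
    obtain ⟨T, _, _, hT⟩ := Core.exists_common_decision (cand := cand) hm
    obtain ⟨t, ht⟩ := htime (T + 1)
    refine ⟨t, fun v => ?_⟩
    obtain ⟨i, hi, hp⟩ := ht v
    rw [outputAt_of_decision hG hc hk hω (hT v) hi hp]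
    simp
  · rcases Nat.lt_or_ge n 2 with hn2 | hn2
    -- For one node the time bound is 0, but the required probability is also 0.
    · have hn1 : n = 1 := by
        have : 0 < n := by
          obtain ⟨r, _⟩ := hc
          exact Fintype.card_pos_iff.2 ⟨r⟩
        omega
      rw [hn1, Nat.cast_one, Real.one_rpow, sub_self]
      exact measureReal_nonneg
    have hn2' : (2 : ℝ) ≤ n := by exact_mod_cast hn2
    have hn0 : (0 : ℝ) < n := by linarith
    have hlog2 : 0 < Real.log 2 := Real.log_pos (by norm_num)
    have hlogn : Real.log 2 ≤ Real.log n := Real.log_le_log (by norm_num) hn2'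
    have hx0 : 0 ≤ (c + 2) * (Real.log n / Real.log 2) := by positivity
    -- Then `n * 2 ^ (-m₀) ≤ n ^ (-c - 1)`, which is at most `n ^ (-c) / 2` as `n ≥ 2`. Ties
    -- contribute the other half.
    set m₀ := ⌈(c + 2) * (Real.log n / Real.log 2)⌉₊ with hm₀
    have hm₀le : (c + 2) * (Real.log n / Real.log 2) ≤ m₀ := Nat.le_ceil _
    have hm₀lt : (m₀ : ℝ) < (c + 2) * (Real.log n / Real.log 2) + 1 := Nat.ceil_lt_add_one hx0
    have hlate : (n : ℝ) * (1 / 2) ^ m₀ ≤ (n : ℝ) ^ (-c) / 2 := by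
      have h1 : (n : ℝ) ^ (c + 2) ≤ 2 ^ m₀ := by
        rw [← Real.rpow_natCast 2 m₀, Real.rpow_def_of_pos hn0, Real.rpow_def_of_pos (by norm_num),
          Real.exp_le_exp]
        calc Real.log n * (c + 2) = Real.log 2 * ((c + 2) * (Real.log n / Real.log 2)) := by
              field_simp
          _ ≤ _ := by gcongr
      have h2 : (n : ℝ) ^ (c + 2) = n ^ c * (n * n) := by
        rw [Real.rpow_add hn0, Real.rpow_two, sq]
      rw [h2] at h1
      have hnc : (0 : ℝ) < (n : ℝ) ^ c := Real.rpow_pos_of_pos hn0 c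
      rw [Real.rpow_neg hn0.le, div_pow, one_pow, mul_one_div, div_le_iff₀ (by positivity),
        inv_eq_one_div, div_div, div_mul_eq_mul_div, one_mul, le_div_iff₀ (by positivity)]
      calc (n : ℝ) * ((n : ℝ) ^ c * 2) ≤ n * (n ^ c * n) := by gcongr
        _ = n ^ c * (n * n) := by ring
        _ ≤ _ := h1
    have htie : 1 / (2 * (n : ℝ) ^ j) ≤ (n : ℝ) ^ (-c) / 2 := by
      have h1 : (n : ℝ) ^ c ≤ n ^ j := by
        rw [← Real.rpow_natCast]
        exact Real.rpow_le_rpow_of_exponent_le (by linarith) (Nat.le_ceil c)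
      have hnc : (0 : ℝ) < (n : ℝ) ^ c := Real.rpow_pos_of_pos hn0 c
      rw [Real.rpow_neg hn0.le, inv_eq_one_div, div_div, mul_comm]
      gcongr
    have hlate' := (measure_late_le (k := k) (L := L) hG hc S m₀).trans hlate
    have htie' := (measure_bad_le hG hc S hk hk0 hL m₀).trans htie
    set late := {ω : A.Choices V | ¬ ∀ v, ∃ i < m₀, (blockCoin k L cand S ω v i).2 = false}
    set tie := {ω : A.Choices V | ¬ ∀ m, 1 ≤ m → m ≤ m₀ → ∀ u v, cand u = true → cand v = true →
        u ≠ v → (∀ w, ∃ i < m, (blockCoin k L cand S ω w i).2 = false) →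
        ¬ ∀ i < m, (blockCoin k L cand S ω u i).1 = (blockCoin k L cand S ω v i).1}
    set inv := {ω : A.Choices V | ¬ ∀ x, ω x ∈ A.τ x.2.2.1 x.2.2.2}
    have hinv : μ.real inv = 0 := by
      rw [measureReal_eq_zero_iff]
      exact A.ae_mem_τ V
    set good := {ω : A.Choices V | (∃ t : ℝ, SelectsLeader cand (A.outputAt cand S ω t)) ∧
      ∀ b : ℝ, S.BoundedBy b → SelectsLeader cand (A.outputAt cand S ω
        (6 * (2 * k + 2) * ((c + 4) / Real.log 2) * N.graph.diam * Real.log n ^ 1 * b))}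
    have hcover : (Set.univ : Set (A.Choices V)) ⊆ good ∪ (late ∪ (tie ∪ inv)) := by
      intro ω _
      by_cases h1 : ω ∈ late
      · exact Or.inr (Or.inl h1)
      by_cases h2 : ω ∈ tie
      · exact Or.inr (Or.inr (Or.inl h2))
      by_cases h3 : ω ∈ inv
      · exact Or.inr (Or.inr (Or.inr h3))
      left
      obtain ⟨l, hl, hlt, hlf⟩ :=
        Core.exists_leader (cand := cand) hc (not_not.1 h1) (not_not.1 h2)
      have hsel : ∀ t : ℝ, (∀ v, ∃ i, S.act v i ≤ t ∧
          (m₀ + 1) * (2 * k + 2) * (N.graph.diam + 1) + 1 ≤ S.pulse v i) →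
          SelectsLeader cand (A.outputAt cand S ω t) := by
        intro t ht
        refine ⟨l, hl, ?_, fun v hv => ?_⟩
        · obtain ⟨i, hi, hp⟩ := ht l
          exact outputAt_of_decision hG hc hk (not_not.1 h3) hlt hi hp
        · obtain ⟨i, hi, hp⟩ := ht v
          exact outputAt_of_decision hG hc hk (not_not.1 h3) (hlf v hv) hi hp
      refine ⟨?_, fun b hb => hsel _ fun v => ?_⟩
      · obtain ⟨t, ht⟩ := htime (m₀ + 1)
        exact ⟨t, hsel t ht⟩
      · obtain ⟨i, hi, hp⟩ := hb.pulse_ge ((m₀ + 1) * (2 * k + 2) * (N.graph.diam + 1)) v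
        refine ⟨i, hi.trans ?_, hp⟩
        have hb0 : 0 < b := (S.act_pos v).trans_le (hb.1 v)
        have hD : 1 ≤ N.graph.diam := by
          have : Nontrivial V := Fintype.one_lt_card_iff_nontrivial.1 hn2
          obtain ⟨x, y, hxy⟩ := exists_pair_ne V
          have hne := hG.nonempty
          have h1 := SimpleGraph.dist_le_diam (u := x) (v := y)
            (SimpleGraph.connected_iff_ediam_ne_top.1 hG)
          have h2 := hG.pos_dist_of_ne hxy
          omega
        have hD' : (1 : ℝ) ≤ N.graph.diam := by exact_mod_cast hD
        have hm : (m₀ : ℝ) + 1 ≤ (c + 4) / Real.log 2 * Real.log n := by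
          have h1 : 1 ≤ Real.log n / Real.log 2 := (one_le_div hlog2).2 hlogn
          have h2 : (c + 4) / Real.log 2 * Real.log n =
            (c + 2) * (Real.log n / Real.log 2) + 2 * (Real.log n / Real.log 2) := by ring
          linarith
        set X := (c + 4) / Real.log 2 * Real.log n
        refine mul_le_mul_of_nonneg_right ?_ hb0.le
        push_cast
        have hp1 : (1 : ℝ) ≤ (m₀ + 1) * (2 * k + 2) * (N.graph.diam + 1) := by
          exact_mod_cast Nat.succ_le_of_lt (by positivity :
            0 < (m₀ + 1) * (2 * k + 2) * (N.graph.diam + 1))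
        -- The constant 6 is 3, from `2 * p + 1 ≤ 3 * p`, times 2, from `D + 1 ≤ 2 * D`.
        calc 2 * (((m₀ : ℝ) + 1) * (2 * k + 2) * (N.graph.diam + 1)) + 1 ≤
              3 * (((m₀ : ℝ) + 1) * (2 * k + 2) * (N.graph.diam + 1)) := by linarith
          _ ≤ 3 * (X * (2 * k + 2) * (N.graph.diam + N.graph.diam)) := by gcongr
          _ = _ := by simp only [X]; ring
    have h1 : 1 ≤ μ.real good + (μ.real late + (μ.real tie + μ.real inv)) := by
      calc (1 : ℝ) = μ.real Set.univ := by simp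
        _ ≤ μ.real (good ∪ (late ∪ (tie ∪ inv))) := measureReal_mono hcover
        _ ≤ _ := (measureReal_union_le _ _).trans (by
            gcongr
            exact (measureReal_union_le _ _).trans (by
              gcongr
              exact measureReal_union_le _ _))
    linarith
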